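/- **Conventions.** A simplicial complex $\Delta$ is *of type* $S=\{\hat a,\hat b,\hat c,\hat d\}$ if all its maximal simplices are $3$-dimensional and there is a function $\mathrm{Type}\colon\Delta^0\to S$ taking distinct values on neighbouring vertices. Let $\mathcal A,\mathcal B,\mathcal C,\mathcal D$ be the sets of vertices of type $\hat a,\hat b,\hat c,\hat d$; vertices denoted $a,a',a_i$ (resp. $b,b_i$; $c,c_i$; $d,d',d_i$) belong to $\mathcal A$ (resp. $\mathcal B$; $\mathcal C$; $\mathcal D$). Order $\hat a<\hat b<\hat c<\hat d$, and for vertices write $x<y$ if $x,y$ are neighbours and $\mathrm{Type}(x)<\mathrm{Type}(y)$. A poset $P$ is *bowtie free* if whenever $x_1,x_2,y_1,y_2\in P$ are distinct with $x_i<y_j$ for all $i,j$, there is $z\in P$ with $x_i\le z\le y_j$ for all $i,j$; it is *upward* (*downward*) *flag* if any three pairwise upper (lower) bounded elements have an upper (lower) bound. A *353-simplicial complex* is a simply connected flag simplicial complex $\Delta$ of type $S$ such that: 1. $<$ is a partial order on $\Delta^0$. 2. For each $d$ (resp. $a$) the set $\mathrm{lk}(d,\Delta)^0$ (resp. $\mathrm{lk}(a,\Delta)^0$),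 with the order $<$, is bowtie free and upward (resp. downward) flag. 3. No cycle $a_1c_1a_2c_2a_3c_3bc_4$ in any $\mathrm{lk}(d,\Delta)$, and no cycle $d_1b_1d_2b_2d_3b_3cb_4$ in any $\mathrm{lk}(a,\Delta)$, is both embedded and induced. 4. If $\gamma=c_1b_1c_2a_2c_3b_3c_4b_4c_5a_5$ is an induced embedded cycle in some $\mathrm{lk}(d,\Delta)$, then some $a\in\mathrm{lk}(d,\Delta)$ is a neighbour of $b_1,b_3,b_4$. Likewise, if $b_1c_1b_2d_2b_3c_3b_4c_4b_5d_5$ is an induced embedded cycle in some $\mathrm{lk}(a,\Delta)$, then some $d\in\mathrm{lk}(a,\Delta)$ is a neighbour of $c_1,c_3,c_4$. A *square complex* with parts $\mathcal A,\mathcal D$ is a combinatorial complex of dimension at most $2$ whose $1$-skeleton is a simplicial graph, bipartite with parts $\mathcal A,\mathcal D$, and whose $2$-cells (*squares*) are attached along distinct embedded $4$-cycles, with which they are identified. A *disc diagram* in a square complex $X$ is a combinatorial map to $X$ from a finite contractible planar complex; its *boundary cycle* is the image of the loop around the planar complex. A *cube corner* in $X$ is a disc diagram whose domain is the union of the three squares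 of the boundary of a cube containing a given vertex, its *centre*. It is *minimal* if its boundary $6$-cycle does not bound a disc diagram in $X$ with fewer than $3$ squares. A *353-square complex* is a simply connected square complex $X$ such that the following hold, and also hold with $\mathcal A$ and $\mathcal D$ interchanged: 1. If $dad_1a'$ and $dad_2a'$ are squares and $d_1\ne d_2$, then $d_1ad_2a'$ is a square. 2. If $d$ is a vertex of a minimal cube corner lying in exactly two of its squares, $ada_1d_1$ and $ada_2d_2$ (so that the centre is $a$), then there is no square $d'a_1da_2$. 3. If $d$ is as in (2) and $a'\neq a$ is such that each of the paths $a_1da'$ and $a_2da'$ lies in a square, then $a'$ is a neighbour of $d_1$ and $d_2$, and $ada'd_1$ and $ada'd_2$ are squares. 4. Suppose that $da_5d_1e_1$, $de_1d_2a_2$, $da_2d_3e_3$, $de_3d_4e_4$, $de_4d_5a_5$, $e_1d_1a_1d_2$, $e_3d_3a_3d_4$, $e_4d_4a_4d_5$ are squares, with $d,d_i\in\mathcal D$ and $a_i,e_i\in\mathcal A$, and that the three cube corners formed by the squares containing $e_1$, $e_3$, $e_4$, respectively (in this list), are minimal. Then there is a neighbour $a'$ of $d$ such that $a'd_ia_id_{i+1}$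 is a square for each $i=1,\dots,5$ (where $d_6=d_1$). **Theorem 9.2.** Let $\Delta$ be a $353$-simplicial complex. Let $X^1\subset\Delta^1$ be the subgraph induced on $\mathcal A\cup\mathcal D$, and let $X$ be the square complex with $1$-skeleton $X^1$ whose squares are the embedded $4$-cycles of $X^1$ having a common neighbour in $\Delta$. Then $X$ is a $353$-square complex. -/

import Mathlib

namespace ThreeFiveThree

/-! ### Simple connectedness of combinatorial 2-complexes -/

/-- Homotopy of edge-paths, relative to the endpoints, in the combinatorial `2`-complex with
`1`-skeleton `G` and with a `2`-cell attached along each closed walk `w` with `R w`: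
the congruence generated by deleting backtracks and by deleting boundaries of `2`-cells. -/
inductive EdgeHomotopic {V : Type*} (G : SimpleGraph V) (R : ∀ u : V, G.Walk u u → Prop) :
    ∀ {u v : V}, G.Walk u v → G.Walk u v → Prop
  | refl {u v : V} (p : G.Walk u v) : EdgeHomotopic G R p p
  | symm {u v : V} {p q : G.Walk u v} :
      EdgeHomotopic G R p q → EdgeHomotopic G R q p
  | trans {u v : V} {p q r : G.Walk u v} :
      EdgeHomotopic G R p q → EdgeHomotopic G R q r → EdgeHomotopic G R p r
  | append {u v w : V} {p p' : G.Walk u v} {q q' : G.Walk v w} :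
      EdgeHomotopic G R p p' → EdgeHomotopic G R q q' →
        EdgeHomotopic G R (p.append q) (p'.append q')
  | backtrack {u v : V} (h : G.Adj u v) :
      EdgeHomotopic G R (.cons h (.cons h.symm .nil)) (.nil : G.Walk u u)
  | cell {u : V} (w : G.Walk u u) : R u w → EdgeHomotopic G R w .nil

/-- Nonempty, connected, and with trivial edge-path group. -/
def SimplyConnected {V : Type*} (G : SimpleGraph V) (R : ∀ u : V, G.Walk u u → Prop) : Prop :=
  G.Connected ∧ ∀ (u : V) (p : G.Walk u u), EdgeHomotopic G R p .nil

/-! ### Simplicial complexes of a given type -/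

/-- The `1`-skeleton: two distinct vertices are neighbours if they lie in a common simplex. -/
def skeleton {V : Type*} (K : PreAbstractSimplicialComplex V) : SimpleGraph V where
  Adj x y := x ≠ y ∧ ∃ s ∈ K.faces, x ∈ s ∧ y ∈ s
  symm := ⟨fun _ _ h => ⟨h.1.symm, h.2.imp fun _ hs => ⟨hs.1, hs.2.2, hs.2.1⟩⟩⟩
  loopless := ⟨fun _ h => h.1 rfl⟩

/-- The vertex set of a simplicial complex. -/
def vertexSet {V : Type*} (K : PreAbstractSimplicialComplex V) : Set V :=
  {x | {x} ∈ K.faces}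

/-- The link of a vertex `x`: all simplices `s` with `x ∉ s` and `{x} ∪ s` a simplex. -/
def link {V : Type*} (K : PreAbstractSimplicialComplex V) (x : V) :
    PreAbstractSimplicialComplex V where
  faces := {s | s.Nonempty ∧ ∃ h : x ∉ s, Finset.cons x s h ∈ K.faces}
  isRelLowerSet_faces := by
    rintro s ⟨hs, hx, hK⟩
    refine ⟨hs, fun t hts ht => ⟨ht, fun h => hx (hts h), ?_⟩⟩
    exact (K.isRelLowerSet_faces hK).2 (Finset.cons_subset_cons.2 hts)
      (Finset.cons_nonempty _)

/-- A flag complex: every finite nonempty set of pairwise neighbouring vertices is a simplex. -/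
def IsFlag {V : Type*} (K : PreAbstractSimplicialComplex V) : Prop :=
  ∀ s : Finset V, s.Nonempty → (∀ x ∈ s, ∀ y ∈ s, x ≠ y → (skeleton K).Adj x y) → s ∈ K.faces

/-- The closed walks bounding the `2`-simplices: those of length three whose vertices
(automatically distinct) lie in a common simplex. -/
def IsTriangle {V : Type*} (K : PreAbstractSimplicialComplex V) (u : V)
    (w : (skeleton K).Walk u u) : Prop :=
  w.length = 3 ∧ ∃ s ∈ K.faces, ∀ x ∈ w.support, x ∈ s

/-- A simplicial complex of type `S` with vertex set `V`. -/
structure TypedComplex (S : Type*) [Fintype S] (V : Type*) extends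
    AbstractSimplicialComplex V where
  /-- The type of a vertex. -/
  type : V → S
  type_ne : ∀ x y : V, (skeleton toPreAbstractSimplicialComplex).Adj x y → type x ≠ type y
  card_of_maximal : ∀ s : Finset V, Maximal (· ∈ faces) s → s.card = Fintype.card S

namespace TypedComplex

variable {S : Type*} [Fintype S] {V : Type*}

/-- The `1`-skeleton. -/
def graph (Δ : TypedComplex S V) : SimpleGraph V := skeleton Δ.toPreAbstractSimplicialComplex

/-- The link of a vertex. -/
def lk (Δ : TypedComplex S V) (x : V) : PreAbstractSimplicialComplex V :=
  link Δ.toPreAbstractSimplicialComplex x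

/-- The relation `<` on the vertices induced by a total order on the set of types. -/
def lt [LinearOrder S] (Δ : TypedComplex S V) (x y : V) : Prop :=
  Δ.graph.Adj x y ∧ Δ.type x < Δ.type y

/-- The reflexive closure of `<`. -/
def le [LinearOrder S] (Δ : TypedComplex S V) (x y : V) : Prop :=
  x = y ∨ Δ.lt x y

end TypedComplex

/-! ### Conditions on posets, for a subset `P` with the order `le` -/

/-- Bowtie freeness. -/
def BowtieFree {V : Type*} (le : V → V → Prop) (P : Set V) : Prop :=
  ∀ x₁ ∈ P, ∀ y₁ ∈ P, ∀ x₂ ∈ P, ∀ y₂ ∈ P, [x₁, y₁, x₂, y₂].Nodup →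
    le x₁ y₁ → le x₁ y₂ → le x₂ y₁ → le x₂ y₂ →
    ∃ z ∈ P, le x₁ z ∧ le x₂ z ∧ le z y₁ ∧ le z y₂

/-- Upward flagness: any three pairwise upper bounded elements have an upper bound. -/
def UpwardFlag {V : Type*} (le : V → V → Prop) (P : Set V) : Prop :=
  ∀ x ∈ P, ∀ y ∈ P, ∀ z ∈ P,
    (∃ u ∈ P, le x u ∧ le y u) → (∃ u ∈ P, le y u ∧ le z u) → (∃ u ∈ P, le x u ∧ le z u) →
    ∃ u ∈ P, le x u ∧ le y u ∧ le z u

/-- Downward flagness: any three pairwise lower bounded elements have a lower bound. -/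
def DownwardFlag {V : Type*} (le : V → V → Prop) (P : Set V) : Prop :=
  UpwardFlag (fun x y => le y x) P

/-! ### 353-simplicial complexes -/

/-- `w 0, …, w (n-1)` is a cycle of `G` that is embedded and induced. -/
def IsInducedCycle {V : Type*} (G : SimpleGraph V) {n : ℕ} [NeZero n] (w : Fin n → V) : Prop :=
  Function.Injective w ∧ (∀ i, G.Adj (w i) (w (i + 1))) ∧
    ∀ i j, G.Adj (w i) (w j) → j = i + 1 ∨ i = j + 1

/-- 353-simplicial complexes. The types `â < b̂ < ĉ < d̂` are `0 < 1 < 2 < 3` in `Fin 4`. -/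
structure Is353Simplicial {V : Type*} (Δ : TypedComplex (Fin 4) V) : Prop where
  flag : IsFlag Δ.toPreAbstractSimplicialComplex
  simplyConnected : SimplyConnected Δ.graph (IsTriangle Δ.toPreAbstractSimplicialComplex)
  /-- The relation `<` is a partial order. -/
  order : IsStrictOrder V Δ.lt
  bowtie_d : ∀ d, Δ.type d = 3 → BowtieFree Δ.le (vertexSet (Δ.lk d))
  bowtie_a : ∀ a, Δ.type a = 0 → BowtieFree Δ.le (vertexSet (Δ.lk a))
  flag_d : ∀ d, Δ.type d = 3 → UpwardFlag Δ.le (vertexSet (Δ.lk d))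
  flag_a : ∀ a, Δ.type a = 0 → DownwardFlag Δ.le (vertexSet (Δ.lk a))
  /-- Cycles `a₁ c₁ a₂ c₂ a₃ c₃ b c₄` in the link of some `d`. -/
  eight_d : ∀ d, Δ.type d = 3 → ∀ w : Fin 8 → V,
    (∀ i, Δ.type (w i) = ![0, 2, 0, 2, 0, 2, 1, 2] i) →
    ¬ IsInducedCycle (skeleton (Δ.lk d)) w
  /-- Cycles `d₁ b₁ d₂ b₂ d₃ b₃ c b₄` in the link of some `a`. -/
  eight_a : ∀ a, Δ.type a = 0 → ∀ w : Fin 8 → V,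
    (∀ i, Δ.type (w i) = ![3, 1, 3, 1, 3, 1, 2, 1] i) →
    ¬ IsInducedCycle (skeleton (Δ.lk a)) w
  /-- Cycles `c₁ b₁ c₂ a₂ c₃ b₃ c₄ b₄ c₅ a₅` in the link of some `d`. -/
  ten_d : ∀ d, Δ.type d = 3 → ∀ w : Fin 10 → V,
    (∀ i, Δ.type (w i) = ![2, 1, 2, 0, 2, 1, 2, 1, 2, 0] i) →
    IsInducedCycle (skeleton (Δ.lk d)) w →
    ∃ a ∈ vertexSet (Δ.lk d), Δ.type a = 0 ∧ ∀ i, Δ.type (w i) = 1 → Δ.graph.Adj a (w i)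
  /-- Cycles `b₁ c₁ b₂ d₂ b₃ c₃ b₄ c₄ b₅ d₅` in the link of some `a`. -/
  ten_a : ∀ a, Δ.type a = 0 → ∀ w : Fin 10 → V,
    (∀ i, Δ.type (w i) = ![1, 2, 1, 3, 1, 2, 1, 2, 1, 3] i) →
    IsInducedCycle (skeleton (Δ.lk a)) w →
    ∃ d ∈ vertexSet (Δ.lk a), Δ.type d = 3 ∧ ∀ i, Δ.type (w i) = 2 → Δ.graph.Adj d (w i)

/-! ### Square complexes -/

/-- A square complex with vertex set `V`. The two parts of the bipartite `1`-skeleton are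
`sideA` and its complement. A `2`-cell is identified with its boundary, an embedded `4`-cycle
considered up to rotation and reflection. -/
structure SquareComplex (V : Type*) where
  /-- The `1`-skeleton. -/
  graph : SimpleGraph V
  /-- The part `𝒜` of the vertex set; the part `𝒟` is its complement. -/
  sideA : Set V
  bipartite : ∀ u v, graph.Adj u v → (u ∈ sideA ↔ v ∉ sideA)
  /-- `IsSquare x y z t` means that the `4`-cycle `x y z t` bounds a `2`-cell. -/
  IsSquare : V → V → V → V → Prop
  adj_of_isSquare : ∀ x y z t, IsSquare x y z t → graph.Adj x y
  ne_of_isSquare : ∀ x y z t, IsSquare x y z t → x ≠ z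
  rotate : ∀ x y z t, IsSquare x y z t → IsSquare y z t x
  reflect : ∀ x y z t, IsSquare x y z t → IsSquare t z y x

/-! ### Disc diagrams -/

/-- A connected finite planar `2`-complex with at least one edge, presented by a rotation system:
`Dart` is the set of oriented edges, `rev` reverses the orientation, `next` sends an oriented edge
to the following one in the cyclic order around its initial vertex. The vertices are the orbits of
`next`, the edges are the orbits of `rev`, and the complementary regions of the `1`-skeleton in
the sphere are the orbits of `face`, the orbit of `root` being the `2`-cell at infinity. Planarity
is Euler's formula. Since the complex is the complement of an open `2`-cell in the sphere, it is
contractible. (The only disc diagram without edges is a single vertex, with boundary of length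
zero.) -/
structure DiscDiagram where
  /-- Oriented edges. -/
  Dart : Type
  finite : Finite Dart
  /-- The next oriented edge around the initial vertex. -/
  next : Equiv.Perm Dart
  /-- The inverse oriented edge. -/
  rev : Equiv.Perm Dart
  rev_rev : ∀ x, rev (rev x) = x
  rev_ne : ∀ x, rev x ≠ x
  connected : ∀ x y, Relation.ReflTransGen (fun u v => v = next u ∨ v = rev u) x y
  /-- An oriented edge from which the boundary cycle is read off. -/
  root : Dart
  euler : Nat.card (Quotient (Equiv.Perm.SameCycle.setoid next)) +
      Nat.card (Quotient (Equiv.Perm.SameCycle.setoid (next * rev))) =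
    Nat.card (Quotient (Equiv.Perm.SameCycle.setoid rev)) + 2

namespace DiscDiagram

/-- The next oriented edge along the boundary of a complementary region. -/
def face (D : DiscDiagram) : Equiv.Perm D.Dart := D.next * D.rev

/-- The number of `2`-cells, not counting the one at infinity. -/
noncomputable def area (D : DiscDiagram) : ℕ :=
  Nat.card (Quotient (Equiv.Perm.SameCycle.setoid D.face)) - 1

end DiscDiagram

namespace SquareComplex

variable {V : Type*}

/-- A disc diagram in `X`: a combinatorial map to `X` from a disc diagram. It is determined by the
images `f x` of the initial vertices of the oriented edges `x`; edges are sent to edges, and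
the `2`-cells are squares mapped homeomorphically to squares of `X`. -/
structure Diagram (X : SquareComplex V) extends DiscDiagram where
  /-- The image of the initial vertex of an oriented edge. -/
  f : Dart → V
  f_next : ∀ x, f (next x) = f x
  f_adj : ∀ x, X.graph.Adj (f x) (f (rev x))
  f_square : ∀ x, ¬ toDiscDiagram.face.SameCycle root x →
    (toDiscDiagram.face ^ 4) x = x ∧
    X.IsSquare (f x) (f (toDiscDiagram.face x)) (f ((toDiscDiagram.face ^ 2) x))
      (f ((toDiscDiagram.face ^ 3) x))

/-- The closed edge-path `w 0, …, w (n-1)` of length `n` is the boundary cycle of `E`. -/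
def Diagram.HasBoundary {X : SquareComplex V} (E : X.Diagram) {n : ℕ} (w : Fin n → V) : Prop :=
  Function.minimalPeriod E.face E.root = n ∧ ∀ i : Fin n, E.f ((E.face ^ (i : ℕ)) E.root) = w i

/-- A cube corner in `X` with centre `o`, neighbours `x₁, x₂, x₃` of the centre, and with `yᵢ`
opposite to `o` in the square not containing `xᵢ`. Its boundary is `x₁ y₃ x₂ y₁ x₃ y₂`. -/
def IsCubeCorner (X : SquareComplex V) (o x₁ x₂ x₃ y₁ y₂ y₃ : V) : Prop :=
  X.IsSquare o x₂ y₁ x₃ ∧ X.IsSquare o x₁ y₂ x₃ ∧ X.IsSquare o x₁ y₃ x₂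

/-- A minimal cube corner: its boundary does not bound a disc diagram with less than `3`
squares. -/
def IsMinimalCubeCorner (X : SquareComplex V) (o x₁ x₂ x₃ y₁ y₂ y₃ : V) : Prop :=
  X.IsCubeCorner o x₁ x₂ x₃ y₁ y₂ y₃ ∧
    ¬ ∃ E : X.Diagram, E.HasBoundary ![x₁, y₃, x₂, y₁, x₃, y₂] ∧ E.area < 3

/-! ### 353-square complexes -/

/-- The closed walks of length four that bound squares. -/
def IsSquareWalk (X : SquareComplex V) (u : V) (w : X.graph.Walk u u) : Prop :=
  w.length = 4 ∧ X.IsSquare u (w.getVert 1) (w.getVert 2) (w.getVert 3)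

/-- The square complex with the roles of `𝒜` and `𝒟` interchanged. -/
def swap (X : SquareComplex V) : SquareComplex V :=
  { X with
    sideA := X.sideAᶜ
    bipartite := fun u v h => by
      have := X.bipartite u v h
      simp only [Set.mem_compl_iff]
      tauto }

/-- If `d a d₁ a'` and `d a d₂ a'` are squares with `d₁ ≠ d₂`, then `d₁ a d₂ a'` is a square. -/
def Axiom1 (X : SquareComplex V) : Prop :=
  ∀ d a d₁ d₂ a' : V, d ∉ X.sideA → d₁ ≠ d₂ →
    X.IsSquare d a d₁ a' → X.IsSquare d a d₂ a' → X.IsSquare d₁ a d₂ a'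

/-- Let `d` lie in exactly two squares `a d a₁ d₁` and `a d a₂ d₂` of a minimal cube corner
(whose centre is thus `a`). Then there is no square `d' a₁ d a₂`. -/
def Axiom2 (X : SquareComplex V) : Prop :=
  ∀ a d d₁ d₂ a₁ a₂ a₃ : V, d ∉ X.sideA → X.IsMinimalCubeCorner a d d₁ d₂ a₃ a₂ a₁ →
    ¬ ∃ d', X.IsSquare d' a₁ d a₂

/-- Let `d` lie in exactly two squares `a d a₁ d₁` and `a d a₂ d₂` of a minimal cube corner.
If `a' ≠ a` and the paths `a₁ d a'` and `a₂ d a'` lie in squares, then `a d a' d₁` and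
`a d a' d₂` are squares. -/
def Axiom3 (X : SquareComplex V) : Prop :=
  ∀ a d d₁ d₂ a₁ a₂ a₃ a' : V, d ∉ X.sideA → X.IsMinimalCubeCorner a d d₁ d₂ a₃ a₂ a₁ →
    a' ≠ a → (∃ d₄, X.IsSquare a₁ d a' d₄) → (∃ d₅, X.IsSquare a₂ d a' d₅) →
    X.graph.Adj a' d₁ ∧ X.graph.Adj a' d₂ ∧ X.IsSquare a d a' d₁ ∧ X.IsSquare a d a' d₂

/-- The diagram `E` has boundary `d₁ a₁ d₂ a₂ d₃ a₃ d₄ a₄ d₅ a₅` and interior vertices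
`d, e₁, e₃, e₄`. Around `d` there are five squares, with the neighbours of `d` being cyclically
`e₁, a₂, e₃, e₄, a₅` and with the vertices opposite to `d` being `d₁, …, d₅`; and there are three
more squares `eᵢ dᵢ aᵢ dᵢ₊₁` for `i = 1, 3, 4`, completing the cube corners with centres
`e₁, e₃, e₄`. The diagram `E'` has the same boundary, a single interior vertex `a'`,
and the five squares `a' dᵢ aᵢ dᵢ₊₁`. -/
def Axiom4 (X : SquareComplex V) : Prop :=
  ∀ d d₁ d₂ d₃ d₄ d₅ a₁ a₂ a₃ a₄ a₅ e₁ e₃ e₄ : V, d ∉ X.sideA →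
    -- the five squares of `E` around `d`
    X.IsSquare d a₅ d₁ e₁ → X.IsSquare d e₁ d₂ a₂ → X.IsSquare d a₂ d₃ e₃ →
    X.IsSquare d e₃ d₄ e₄ → X.IsSquare d e₄ d₅ a₅ →
    -- the three remaining squares of `E`
    X.IsSquare e₁ d₁ a₁ d₂ → X.IsSquare e₃ d₃ a₃ d₄ → X.IsSquare e₄ d₄ a₄ d₅ →
    -- the cube corners of `E` are minimal
    X.IsMinimalCubeCorner e₁ d d₁ d₂ a₁ a₂ a₅ →
    X.IsMinimalCubeCorner e₃ d d₃ d₄ a₃ e₄ a₂ →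
    X.IsMinimalCubeCorner e₄ d d₄ d₅ a₄ a₅ e₃ →
    ∃ a', X.graph.Adj a' d ∧
      X.IsSquare a' d₁ a₁ d₂ ∧ X.IsSquare a' d₂ a₂ d₃ ∧ X.IsSquare a' d₃ a₃ d₄ ∧
      X.IsSquare a' d₄ a₄ d₅ ∧ X.IsSquare a' d₅ a₅ d₁

/-- 353-square complexes. -/
structure Is353 (X : SquareComplex V) : Prop where
  simplyConnected : SimplyConnected X.graph X.IsSquareWalk
  axiom1 : X.Axiom1
  axiom2 : X.Axiom2
  axiom3 : X.Axiom3
  axiom4 : X.Axiom4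
  swap1 : X.swap.Axiom1
  swap2 : X.swap.Axiom2
  swap3 : X.swap.Axiom3
  swap4 : X.swap.Axiom4

end SquareComplex

/-! ### The square complex of a complex of type `{â, b̂, ĉ, d̂}` -/

/-- The square complex whose `1`-skeleton is the subgraph of the `1`-skeleton of `Δ` induced on
`𝒜 ∪ 𝒟` and whose squares are the embedded `4`-cycles with a common neighbour in `Δ`. -/
def squareComplex {V : Type*} (Δ : TypedComplex (Fin 4) V) :
    SquareComplex {v : V // Δ.type v = 0 ∨ Δ.type v = 3} where
  graph := Δ.graph.comap Subtype.val
  sideA := {v | Δ.type v = 0}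
  bipartite := by
    rintro ⟨u, hu⟩ ⟨v, hv⟩ h
    have := Δ.type_ne u v h
    simp only [Set.mem_ofPred_eq]
    grind
  IsSquare x y z t :=
    (Δ.graph.Adj x y ∧ Δ.graph.Adj y z ∧ Δ.graph.Adj z t ∧ Δ.graph.Adj t x ∧ x ≠ z ∧ y ≠ t) ∧
      ∃ v : V, Δ.graph.Adj v x ∧ Δ.graph.Adj v y ∧ Δ.graph.Adj v z ∧ Δ.graph.Adj v t
  adj_of_isSquare _ _ _ _ h := h.1.1
  ne_of_isSquare _ _ _ _ h := h.1.2.2.2.2.1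
  rotate := by
    rintro x y z t ⟨⟨h1, h2, h3, h4, h5, h6⟩, v, v1, v2, v3, v4⟩
    exact ⟨⟨h2, h3, h4, h1, h6, h5.symm⟩, v, v2, v3, v4, v1⟩
  reflect := by
    rintro x y z t ⟨⟨h1, h2, h3, h4, h5, h6⟩, v, v1, v2, v3, v4⟩
    exact ⟨⟨h3.symm, h2.symm, h1.symm, h4.symm, h6.symm, h5.symm⟩, v, v4, v3, v2, v1⟩

end ThreeFiveThree

/-! All conditions on squares become statements about the order. A 4-cycle `a d a' d'` of `X` is a
square exactly when `a ≠ a'`, `d ≠ d'` and some `v` satisfies `a, a' < v < d, d'`. Minimality of a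
cube corner enters only through explicit diagrams with at most two squares: a 6-cycle that can be
cut along a diagonal joining opposite vertices, where a half may collapse to an edge, is not the
boundary of a minimal corner.

Take an unfilled corner with centre `a`, neighbours `xᵢ` of the centre and opposite vertices `yᵢ`.
Downward flagness in the link of `a` gives a common lower bound of the `xᵢ`. If it had type 2 it
would cone off the whole corner and allow a cut, so it has type 1; call it `b`. Joining it with the
old cone points gives three distinct cone points `cᵢ > b` of type 2, with no `yᵢ` below `b`
(`exists_cornerCone`). The central consequence (`lt_or_lt_of_bounded`, `not_bounded`) is that `y₂`
and `y₃` have no common upper bound in the link of `x₁`: otherwise upward flagness would produce a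
hexagon in the link of the edge `a x₁`, and flagness and bowtie freeness collapse such hexagons.

Axiom 1 is one application of bowtie freeness, and Axiom 2 is the nonexistence of that upper bound.
In Axiom 3, if `a'` is not below `b`, there is an induced 8-cycle through `a'`, the `y`'s, `b` and
cone points in the link of `x₁`, which is forbidden. In Axiom 4 the cone points of the five squares
around `d`, the vertices `b` of the three corners, `a₂` and `a₅` form an induced 10-cycle in the
link of `d`; the vertex given by the 10-cycle condition is the required `a'` (`exists_replacement`).
The versions with `𝒜` and `𝒟` interchanged follow by reversing the order of types
(`Is353Graph.dual`).

For simple connectedness, the star of any simplex meets `X` in a complete bipartite graph all of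
whose 4-cycles are squares, so paths inside it are determined up to homotopy by their ends. This
lets edge-paths of `Δ` be pushed into `X` compatibly with triangles, so null-homotopies in `Δ` carry
over to `X`. -/

namespace ThreeFiveThree

/-! ### Small disc diagrams -/

/-- The number of cycles of `σ`, counted by a labelling `g` of the cycles, with representatives
`r`. -/
theorem card_cycles {α : Type*} {k : ℕ} (σ : Equiv.Perm α) (g : α → Fin k) (r : Fin k → α)
    (t : α → ℕ) (hg : ∀ x, g (σ x) = g x) (hr : ∀ i, g (r i) = i)
    (ht : ∀ x, (⇑σ)^[t x] (r (g x)) = x) :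
    Nat.card (Quotient (Equiv.Perm.SameCycle.setoid σ)) = k := by
  have hgp : ∀ (n : ℕ) x, g ((σ ^ n) x) = g x := by
    intro n
    induction n with
    | zero => simp
    | succ n ih => intro x; rw [pow_succ', Equiv.Perm.mul_apply, hg, ih]
  have hgz : ∀ (n : ℤ) x, g ((σ ^ n) x) = g x := by
    intro n x
    cases n with
    | ofNat n => simpa using hgp n x
    | negSucc n =>
      have := hgp (n + 1) ((σ ^ (Int.negSucc n)) x)
      rw [← this, zpow_negSucc]
      simp
  have hsame : ∀ x, σ.SameCycle (r (g x)) x := fun x =>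
    ⟨(t x : ℤ), by rw [zpow_natCast, ← Equiv.Perm.iterate_eq_pow]; exact ht x⟩
  rw [← Nat.card_fin k]
  refine Nat.card_congr
    { toFun := Quotient.lift g ?_
      invFun := fun i => Quotient.mk _ (r i)
      left_inv := ?_
      right_inv := fun i => hr i }
  · rintro x y ⟨n, rfl⟩
    exact (hgz n x).symm
  · intro q
    induction q using Quotient.ind with
    | _ x => exact Quotient.sound (hsame x)

/-- Connectedness from explicit words in the two permutations. -/
theorem reflTransGen_of_words {α : Type*} (p q : α → α) (o : α) (w w' : α → List Bool)
    (hw : ∀ x, (w x).foldl (fun y s => if s then p y else q y) o = x)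
    (hw' : ∀ x, (w' x).foldl (fun y s => if s then p y else q y) x = o) (x y : α) :
    Relation.ReflTransGen (fun u v => v = p u ∨ v = q u) x y := by
  have key : ∀ (l : List Bool) (z : α), Relation.ReflTransGen (fun u v => v = p u ∨ v = q u) z
      (l.foldl (fun y s => if s then p y else q y) z) := by
    intro l
    induction l with
    | nil => exact fun z => .refl
    | cons s l ih =>
      intro z
      refine .head (b := if s then p z else q z) ?_ (ih _)
      cases s <;> simp
  have h1 := key (w' x) x
  have h2 := key (w y) o
  rw [hw'] at h1
  rw [hw] at h2
  exact h1.trans h2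

/-- The period divides 6 but neither 2 nor 3, which leaves only 6. -/
theorem minimalPeriod_eq_six {α : Type*} (f : α → α) (x : α) (h6 : f^[6] x = x)
    (h2 : f^[2] x ≠ x) (h3 : f^[3] x ≠ x) : Function.minimalPeriod f x = 6 := by
  have hd : Function.minimalPeriod f x ∣ 6 := Function.IsPeriodicPt.minimalPeriod_dvd h6
  have hp : f^[Function.minimalPeriod f x] x = x := Function.isPeriodicPt_minimalPeriod f x
  have n2 : ¬ Function.minimalPeriod f x ∣ 2 := fun h =>
    h2 (Function.isPeriodicPt_iff_minimalPeriod_dvd.2 h)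
  have n3 : ¬ Function.minimalPeriod f x ∣ 3 := fun h =>
    h3 (Function.isPeriodicPt_iff_minimalPeriod_dvd.2 h)
  have hle := Nat.le_of_dvd (by norm_num) hd
  interval_cases Function.minimalPeriod f x <;> simp_all

/-- A permutation of `Fin n` given by its table and the table of its inverse. -/
def permOfTables {n : ℕ} (p q : Fin n → Fin n) (h : ∀ x, q (p x) = x) (h' : ∀ x, p (q x) = x) :
    Equiv.Perm (Fin n) := ⟨p, q, h, h'⟩

namespace Domino

/-- The rotation around the initial vertices. -/
def next : Equiv.Perm (Fin 14) :=
  permOfTables ![12, 6, 7, 13, 9, 10, 1, 2, 3, 4, 5, 0, 11, 8]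
    ![11, 6, 7, 8, 9, 10, 1, 2, 13, 4, 5, 12, 0, 3] (by decide) (by decide)

/-- The reversal of oriented edges. -/
def rev : Equiv.Perm (Fin 14) :=
  permOfTables ![6, 7, 8, 9, 10, 11, 0, 1, 2, 3, 4, 5, 13, 12]
    ![6, 7, 8, 9, 10, 11, 0, 1, 2, 3, 4, 5, 13, 12] (by decide) (by decide)

theorem card_faces :
    Nat.card (Quotient (Equiv.Perm.SameCycle.setoid (next * rev))) = 3 :=
  card_cycles (k := 3) _ ![0, 0, 0, 0, 0, 0, 1, 1, 1, 2, 2, 2, 1, 2]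
      ![0, 6, 9]
      ![0, 1, 2, 3, 4, 5, 0, 3, 2, 0, 3, 2, 1, 1]
    (by decide) (by decide) (by decide)

/-- Two squares sharing an edge. The boundary is formed by the oriented edges `0, …, 5`. -/
def disc : DiscDiagram where
  Dart := Fin 14
  finite := inferInstance
  next := next
  rev := rev
  rev_rev := by decide
  rev_ne := by decide
  connected := reflTransGen_of_words next rev 0
    ![[],
      [false, true],
      [true, false, true, false],
      [true, false, true, true],
      [true, true, false, true, false],
      [true, true, false],
      [false],
      [false, true, false],
      [true, false, true],
      [true, false, true, true, false],
      [true, true, false, true],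
      [true, true],
      [true],
      [true, false]]
    ![[],
      [true, false],
      [true, false, true, false],
      [true, false, true, true],
      [false, true, false, true],
      [false, true],
      [false],
      [false, true, false],
      [true, true, false, true, true],
      [true, false, true, false, true],
      [true, false, true],
      [true],
      [true, true],
      [false, true, true]]
    (by decide) (by decide)
  root := (0 : Fin 14)
  euler := by
    rw [card_faces, card_cycles (k := 6) next ![0, 1, 2, 3, 4, 5, 1, 2, 3, 4, 5, 0, 0, 3]
      ![0, 1, 2, 3, 4, 5]
      ![0, 0, 0, 0, 0, 0, 1, 1, 2, 1, 1, 2, 1, 1]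
      (by decide) (by decide) (by decide),
      card_cycles (k := 7) rev ![0, 1, 2, 3, 4, 5, 0, 1, 2, 3, 4, 5, 6, 6]
      ![0, 1, 2, 3, 4, 5, 12]
      ![0, 0, 0, 0, 0, 0, 1, 1, 1, 1, 1, 1, 0, 1]
      (by decide) (by decide) (by decide)]

theorem minimalPeriod_face : Function.minimalPeriod disc.face disc.root = 6 :=
  minimalPeriod_eq_six (next * rev) (0 : Fin 14) (by decide) (by decide) (by decide)

theorem area_disc : disc.area < 3 := by
  -- One of the three faces is the cell at infinity.
  have : disc.area = 3 - 1 := congrArg (· - 1) card_faces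
  omega

end Domino

namespace SquareHairOne

/-- The rotation around the initial vertices. -/
def next : Equiv.Perm (Fin 10) :=
  permOfTables ![9, 3, 2, 6, 7, 8, 1, 4, 5, 0]
    ![9, 6, 2, 1, 7, 8, 3, 4, 5, 0] (by decide) (by decide)

/-- The reversal of oriented edges. -/
def rev : Equiv.Perm (Fin 10) :=
  permOfTables ![6, 2, 1, 7, 8, 9, 0, 3, 4, 5]
    ![6, 2, 1, 7, 8, 9, 0, 3, 4, 5] (by decide) (by decide)

theorem card_faces :
    Nat.card (Quotient (Equiv.Perm.SameCycle.setoid (next * rev))) = 2 :=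
  card_cycles (k := 2) _ ![0, 0, 0, 0, 0, 0, 1, 1, 1, 1]
      ![0, 6]
      ![0, 1, 2, 3, 4, 5, 0, 3, 2, 1]
    (by decide) (by decide) (by decide)

/-- A square with an edge attached at a vertex, the free end being the third vertex of the
boundary. -/
def disc : DiscDiagram where
  Dart := Fin 10
  finite := inferInstance
  next := next
  rev := rev
  rev_rev := by decide
  rev_ne := by decide
  connected := reflTransGen_of_words next rev 0
    ![[],
      [false, true],
      [false, true, false],
      [false, true, true],
      [true, false, true, false],
      [true, false],
      [false],
      [false, true, true, false],
      [true, false, true],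
      [true]]
    ![[],
      [true, true, false],
      [false, true, true, false],
      [true, false],
      [true, false, true, false],
      [false, true],
      [false],
      [false, true, false],
      [true, false, true],
      [true]]
    (by decide) (by decide)
  root := (0 : Fin 10)
  euler := by
    rw [card_faces, card_cycles (k := 5) next ![0, 1, 2, 1, 3, 4, 1, 3, 4, 0]
      ![0, 1, 2, 4, 5]
      ![0, 0, 0, 1, 0, 0, 2, 1, 1, 1]
      (by decide) (by decide) (by decide),
      card_cycles (k := 5) rev ![0, 1, 1, 2, 3, 4, 0, 2, 3, 4]
      ![0, 1, 3, 4, 5]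
      ![0, 0, 1, 0, 0, 0, 1, 1, 1, 1]
      (by decide) (by decide) (by decide)]

theorem minimalPeriod_face : Function.minimalPeriod disc.face disc.root = 6 :=
  minimalPeriod_eq_six (next * rev) (0 : Fin 10) (by decide) (by decide) (by decide)

theorem area_disc : disc.area < 3 := by
  have : disc.area = 2 - 1 := congrArg (· - 1) card_faces
  omega

end SquareHairOne

namespace SquareHairTwo

/-- The rotation around the initial vertices. -/
def next : Equiv.Perm (Fin 10) :=
  permOfTables ![9, 6, 7, 5, 4, 8, 1, 2, 3, 0]
    ![9, 6, 7, 8, 4, 3, 1, 2, 5, 0] (by decide) (by decide)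

/-- The reversal of oriented edges. -/
def rev : Equiv.Perm (Fin 10) :=
  permOfTables ![6, 7, 8, 4, 3, 9, 0, 1, 2, 5]
    ![6, 7, 8, 4, 3, 9, 0, 1, 2, 5] (by decide) (by decide)

theorem card_faces :
    Nat.card (Quotient (Equiv.Perm.SameCycle.setoid (next * rev))) = 2 :=
  card_cycles (k := 2) _ ![0, 0, 0, 0, 0, 0, 1, 1, 1, 1]
      ![0, 6]
      ![0, 1, 2, 3, 4, 5, 0, 3, 2, 1]
    (by decide) (by decide) (by decide)

/-- A square with an edge attached at a vertex, the free end being the fifth vertex of the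
boundary. -/
def disc : DiscDiagram where
  Dart := Fin 10
  finite := inferInstance
  next := next
  rev := rev
  rev_rev := by decide
  rev_ne := by decide
  connected := reflTransGen_of_words next rev 0
    ![[],
      [false, true],
      [true, false, true, false],
      [true, false, true, true],
      [true, false, true, true, false],
      [true, false],
      [false],
      [false, true, false],
      [true, false, true],
      [true]]
    ![[],
      [true, false],
      [true, false, true, false],
      [true, false, true],
      [false, true, false, true],
      [false, true],
      [false],
      [false, true, false],
      [true, true, false, true],
      [true]]
    (by decide) (by decide)
  root := (0 : Fin 10)
  euler := by
    rw [card_faces, card_cycles (k := 5) next ![0, 1, 2, 3, 4, 3, 1, 2, 3, 0]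
      ![0, 1, 2, 3, 4]
      ![0, 0, 0, 0, 0, 1, 1, 1, 2, 1]
      (by decide) (by decide) (by decide),
      card_cycles (k := 5) rev ![0, 1, 2, 3, 3, 4, 0, 1, 2, 4]
      ![0, 1, 2, 3, 5]
      ![0, 0, 0, 0, 1, 0, 1, 1, 1, 1]
      (by decide) (by decide) (by decide)]

theorem minimalPeriod_face : Function.minimalPeriod disc.face disc.root = 6 :=
  minimalPeriod_eq_six (next * rev) (0 : Fin 10) (by decide) (by decide) (by decide)

theorem area_disc : disc.area < 3 := by
  have : disc.area = 2 - 1 := congrArg (· - 1) card_faces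
  omega

end SquareHairTwo

namespace Tripod

/-- The rotation around the initial vertices. -/
def next : Equiv.Perm (Fin 6) :=
  permOfTables ![0, 3, 2, 5, 4, 1]
    ![0, 5, 2, 1, 4, 3] (by decide) (by decide)

/-- The reversal of oriented edges. -/
def rev : Equiv.Perm (Fin 6) :=
  permOfTables ![5, 2, 1, 4, 3, 0]
    ![5, 2, 1, 4, 3, 0] (by decide) (by decide)

theorem card_faces :
    Nat.card (Quotient (Equiv.Perm.SameCycle.setoid (next * rev))) = 1 :=
  card_cycles (k := 1) _ ![0, 0, 0, 0, 0, 0]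
      ![0]
      ![0, 1, 2, 3, 4, 5]
    (by decide) (by decide) (by decide)

/-- A tree with three edges and three leaves. -/
def disc : DiscDiagram where
  Dart := Fin 6
  finite := inferInstance
  next := next
  rev := rev
  rev_rev := by decide
  rev_ne := by decide
  connected := reflTransGen_of_words next rev 0
    ![[],
      [false, true],
      [false, true, false],
      [false, true, true],
      [false, true, true, false],
      [false]]
    ![[],
      [true, true, false],
      [false, true, true, false],
      [true, false],
      [false, true, false],
      [false]]
    (by decide) (by decide)
  root := (0 : Fin 6)
  euler := by
    rw [card_faces, card_cycles (k := 4) next ![0, 1, 2, 1, 3, 1]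
      ![0, 1, 2, 4]
      ![0, 0, 0, 1, 0, 2]
      (by decide) (by decide) (by decide),
      card_cycles (k := 3) rev ![0, 1, 1, 2, 2, 0]
      ![0, 1, 3]
      ![0, 0, 1, 0, 1, 1]
      (by decide) (by decide) (by decide)]

theorem minimalPeriod_face : Function.minimalPeriod disc.face disc.root = 6 :=
  minimalPeriod_eq_six (next * rev) (0 : Fin 6) (by decide) (by decide) (by decide)

theorem area_disc : disc.area < 3 := by
  have : disc.area = 1 - 1 := congrArg (· - 1) card_faces
  omega

end Tripod

/-! ### Filling the boundary of a cube corner by at most two squares -/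

namespace SquareComplex

variable {V : Type*} {X : SquareComplex V}

theorem adj₂ {x y z t : V} (h : X.IsSquare x y z t) : X.graph.Adj y z :=
  X.adj_of_isSquare _ _ _ _ (X.rotate _ _ _ _ h)

theorem adj₃ {x y z t : V} (h : X.IsSquare x y z t) : X.graph.Adj z t :=
  adj₂ (X.rotate _ _ _ _ h)

theorem adj₄ {x y z t : V} (h : X.IsSquare x y z t) : X.graph.Adj t x :=
  adj₃ (X.rotate _ _ _ _ h)

theorem exists_domino {w₀ w₁ w₂ w₃ w₄ w₅ : V} (h : X.IsSquare w₀ w₁ w₂ w₃)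
    (h' : X.IsSquare w₀ w₃ w₄ w₅) :
    ∃ E : X.Diagram, E.HasBoundary ![w₀, w₁, w₂, w₃, w₄, w₅] ∧ E.area < 3 := by
  have a₁ := X.adj_of_isSquare _ _ _ _ h
  have a₂ := adj₂ h
  have a₃ := adj₃ h
  have a₄ := adj₄ h
  have b₂ := adj₂ h'
  have b₃ := adj₃ h'
  have b₄ := adj₄ h'
  let f : Fin 14 → V := ![w₀, w₁, w₂, w₃, w₄, w₅, w₁, w₂, w₃, w₄, w₅, w₀, w₀, w₃]
  -- The inner faces traverse the squares in the sense opposite to the boundary darts `0, …, 5`,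
  -- hence the reflections. Darts `6, …, 11` are the reverses of these, and `12`, `13` form the
  -- common edge `w₀ w₃`.
  have hs := X.reflect _ _ _ _ h
  have hs' := X.reflect _ _ _ _ h'
  refine ⟨⟨Domino.disc, f, ?_, ?_, ?_⟩, ⟨Domino.minimalPeriod_face, ?_⟩, Domino.area_disc⟩
  · intro x
    change Fin 14 at x
    fin_cases x <;> rfl
  · intro x
    change Fin 14 at x
    fin_cases x <;> first
      | exact a₁ | exact a₂ | exact a₄.symm | exact b₂ | exact b₃ | exact b₄
      | exact a₁.symm | exact a₂.symm | exact a₃.symm | exact a₃ | exact b₂.symm | exact b₃.symm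
      | exact b₄.symm | exact a₄
  · intro x hx
    change Fin 14 at x
    have hn : ∀ n : ℕ, ((Domino.next * Domino.rev) ^ n) (0 : Fin 14) ≠ x := fun n hn =>
      hx ⟨n, by rw [zpow_natCast]; exact hn⟩
    fin_cases x
    · exact absurd rfl (hn 0)
    · exact absurd rfl (hn 1)
    · exact absurd rfl (hn 2)
    · exact absurd rfl (hn 3)
    · exact absurd rfl (hn 4)
    · exact absurd rfl (hn 5)
    · exact ⟨rfl, X.rotate _ _ _ _ (X.rotate _ _ _ _ hs)⟩
    · exact ⟨rfl, X.rotate _ _ _ _ hs⟩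
    · exact ⟨rfl, hs⟩
    · exact ⟨rfl, X.rotate _ _ _ _ hs'⟩
    · exact ⟨rfl, hs'⟩
    · exact ⟨rfl, X.rotate _ _ _ _ (X.rotate _ _ _ _ (X.rotate _ _ _ _ hs'))⟩
    · exact ⟨rfl, X.rotate _ _ _ _ (X.rotate _ _ _ _ (X.rotate _ _ _ _ hs))⟩
    · exact ⟨rfl, X.rotate _ _ _ _ (X.rotate _ _ _ _ hs')⟩
  · intro i
    fin_cases i <;> rfl

/-- The degenerate domino in which the first square has collapsed to the edge `w₁ w₂`. -/
theorem exists_squareHairOne {w₀ w₁ w₂ w₄ w₅ : V} (h : X.IsSquare w₀ w₁ w₄ w₅)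
    (h' : X.graph.Adj w₁ w₂) :
    ∃ E : X.Diagram, E.HasBoundary ![w₀, w₁, w₂, w₁, w₄, w₅] ∧ E.area < 3 := by
  have a₁ := X.adj_of_isSquare _ _ _ _ h
  have a₂ := adj₂ h
  have a₃ := adj₃ h
  have a₄ := adj₄ h
  let f : Fin 10 → V := ![w₀, w₁, w₂, w₁, w₄, w₅, w₁, w₄, w₅, w₀]
  have hs := X.reflect _ _ _ _ h
  refine ⟨⟨SquareHairOne.disc, f, ?_, ?_, ?_⟩, ⟨SquareHairOne.minimalPeriod_face, ?_⟩,
    SquareHairOne.area_disc⟩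
  · intro x
    change Fin 10 at x
    fin_cases x <;> rfl
  · intro x
    change Fin 10 at x
    fin_cases x <;> first
      | exact a₁ | exact a₂ | exact a₃ | exact a₄ | exact h'
      | exact a₁.symm | exact a₂.symm | exact a₃.symm | exact a₄.symm | exact h'.symm
  · intro x hx
    change Fin 10 at x
    have hn : ∀ n : ℕ, ((SquareHairOne.next * SquareHairOne.rev) ^ n) (0 : Fin 10) ≠ x :=
      fun n hn => hx ⟨n, by rw [zpow_natCast]; exact hn⟩
    fin_cases x
    · exact absurd rfl (hn 0)
    · exact absurd rfl (hn 1)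
    · exact absurd rfl (hn 2)
    · exact absurd rfl (hn 3)
    · exact absurd rfl (hn 4)
    · exact absurd rfl (hn 5)
    · exact ⟨rfl, X.rotate _ _ _ _ (X.rotate _ _ _ _ hs)⟩
    · exact ⟨rfl, X.rotate _ _ _ _ hs⟩
    · exact ⟨rfl, hs⟩
    · exact ⟨rfl, X.rotate _ _ _ _ (X.rotate _ _ _ _ (X.rotate _ _ _ _ hs))⟩
  · intro i
    fin_cases i <;> rfl

/-- The degenerate domino in which the second square has collapsed to the edge `w₃ w₄`. -/
theorem exists_squareHairTwo {w₀ w₁ w₂ w₃ w₄ : V} (h : X.IsSquare w₀ w₁ w₂ w₃)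
    (h' : X.graph.Adj w₃ w₄) :
    ∃ E : X.Diagram, E.HasBoundary ![w₀, w₁, w₂, w₃, w₄, w₃] ∧ E.area < 3 := by
  have a₁ := X.adj_of_isSquare _ _ _ _ h
  have a₂ := adj₂ h
  have a₃ := adj₃ h
  have a₄ := adj₄ h
  let f : Fin 10 → V := ![w₀, w₁, w₂, w₃, w₄, w₃, w₁, w₂, w₃, w₀]
  have hs := X.reflect _ _ _ _ h
  refine ⟨⟨SquareHairTwo.disc, f, ?_, ?_, ?_⟩, ⟨SquareHairTwo.minimalPeriod_face, ?_⟩,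
    SquareHairTwo.area_disc⟩
  · intro x
    change Fin 10 at x
    fin_cases x <;> rfl
  · intro x
    change Fin 10 at x
    fin_cases x <;> first
      | exact a₁ | exact a₂ | exact a₃ | exact a₄ | exact h'
      | exact a₁.symm | exact a₂.symm | exact a₃.symm | exact a₄.symm | exact h'.symm
  · intro x hx
    change Fin 10 at x
    have hn : ∀ n : ℕ, ((SquareHairTwo.next * SquareHairTwo.rev) ^ n) (0 : Fin 10) ≠ x :=
      fun n hn => hx ⟨n, by rw [zpow_natCast]; exact hn⟩
    fin_cases x
    · exact absurd rfl (hn 0)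
    · exact absurd rfl (hn 1)
    · exact absurd rfl (hn 2)
    · exact absurd rfl (hn 3)
    · exact absurd rfl (hn 4)
    · exact absurd rfl (hn 5)
    · exact ⟨rfl, X.rotate _ _ _ _ (X.rotate _ _ _ _ hs)⟩
    · exact ⟨rfl, X.rotate _ _ _ _ hs⟩
    · exact ⟨rfl, hs⟩
    · exact ⟨rfl, X.rotate _ _ _ _ (X.rotate _ _ _ _ (X.rotate _ _ _ _ hs))⟩
  · intro i
    fin_cases i <;> rfl

theorem exists_tripod {x y z o : V} (hx : X.graph.Adj x o) (hy : X.graph.Adj y o)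
    (hz : X.graph.Adj z o) :
    ∃ E : X.Diagram, E.HasBoundary ![x, o, y, o, z, o] ∧ E.area < 3 := by
  let f : Fin 6 → V := ![x, o, y, o, z, o]
  refine ⟨⟨Tripod.disc, f, ?_, ?_, ?_⟩, ⟨Tripod.minimalPeriod_face, ?_⟩, Tripod.area_disc⟩
  · intro x
    change Fin 6 at x
    fin_cases x <;> rfl
  · intro x
    change Fin 6 at x
    fin_cases x <;> first
      | exact hx | exact hx.symm | exact hy | exact hy.symm | exact hz | exact hz.symm
  · intro x hx
    change Fin 6 at x
    have hn : ∀ n : ℕ, ((Tripod.next * Tripod.rev) ^ n) (0 : Fin 6) ≠ x :=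
      fun n hn => hx ⟨n, by rw [zpow_natCast]; exact hn⟩
    fin_cases x
    · exact absurd rfl (hn 0)
    · exact absurd rfl (hn 1)
    · exact absurd rfl (hn 2)
    · exact absurd rfl (hn 3)
    · exact absurd rfl (hn 4)
    · exact absurd rfl (hn 5)
  · intro i
    fin_cases i <;> rfl

/-- Changing the initial point of the boundary cycle. -/
def Diagram.reroot (E : X.Diagram) (k : ℕ) : X.Diagram where
  __ := E
  root := (E.face ^ k) E.root
  f_square x hx := E.f_square x fun h => hx <| by
    obtain ⟨n, hn⟩ := h
    refine ⟨n - k, ?_⟩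
    change (E.face ^ (n - k : ℤ)) ((E.face ^ k) E.root) = x
    rw [← hn, ← zpow_natCast, ← Equiv.Perm.mul_apply, ← zpow_add]
    simp

theorem IsMinimalCubeCorner.rotate {o x₁ x₂ x₃ y₁ y₂ y₃ : V}
    (h : X.IsMinimalCubeCorner o x₁ x₂ x₃ y₁ y₂ y₃) :
    X.IsMinimalCubeCorner o x₂ x₃ x₁ y₂ y₃ y₁ := by
  obtain ⟨⟨s₁, s₂, s₃⟩, h⟩ := h
  have flip : ∀ {o x y z : V}, X.IsSquare o x y z → X.IsSquare o z y x := fun hs =>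
    X.rotate _ _ _ _ (X.rotate _ _ _ _ (X.rotate _ _ _ _ (X.reflect _ _ _ _ hs)))
  refine ⟨⟨flip s₂, flip s₃, s₁⟩, ?_⟩
  rintro ⟨E, ⟨hp, hb⟩, ha⟩
  -- In the rotated boundary `x₂ y₁ x₃ y₂ x₁ y₃` the original starting vertex `x₁` stands at
  -- position 4, counting from 0.
  refine h ⟨E.reroot 4, ⟨?_, fun i => ?_⟩, ha⟩
  · have : Function.minimalPeriod E.face ((E.face ^ 4) E.root) = 6 := by
      rw [← Equiv.Perm.iterate_eq_pow, Function.minimalPeriod_apply_iterate ?_ 4]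
      · exact hp
      · exact Function.minimalPeriod_pos_iff_mem_periodicPts.1 (hp ▸ by norm_num)
    exact this
  · have h6 : (E.face ^ 6) E.root = E.root := by
      rw [← Equiv.Perm.iterate_eq_pow]
      exact Function.isPeriodicPt_iff_minimalPeriod_dvd.2 (dvd_of_eq hp)
    change E.f ((E.face ^ (i : ℕ)) ((E.face ^ 4) E.root)) = _
    rw [← Equiv.Perm.mul_apply, ← pow_add]
    fin_cases i
    · exact hb 4
    · exact hb 5
    · simpa [h6] using hb 0
    · simpa [pow_succ' E.face 6, h6] using hb 1
    · simpa [pow_add E.face 2 6, h6] using hb 2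
    · simpa [pow_add E.face 3 6, h6] using hb 3

/-- The boundary of a minimal cube corner cannot be filled along the diagonal `x₁ y₁`. -/
theorem IsMinimalCubeCorner.not_fill {o x₁ x₂ x₃ y₁ y₂ y₃ : V}
    (h : X.IsMinimalCubeCorner o x₁ x₂ x₃ y₁ y₂ y₃) :
    ¬ ((y₁ = y₃ ∨ X.IsSquare x₁ y₃ x₂ y₁) ∧ (y₁ = y₂ ∨ X.IsSquare x₁ y₁ x₃ y₂)) := by
  obtain ⟨⟨s₁, s₂, s₃⟩, h⟩ := h
  -- Each half is a square or collapses to an edge, which gives a tripod, a square with a hair in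
  -- two ways, or a domino.
  rintro ⟨rfl | h₁, rfl | h₂⟩
  · exact h (exists_tripod (adj₂ s₃) (adj₂ s₁) (adj₃ s₁).symm)
  · exact h (exists_squareHairOne h₂ (adj₂ s₁).symm)
  · exact h (exists_squareHairTwo h₁ (adj₃ s₁))
  · exact h (exists_domino h₁ h₂)

end SquareComplex

namespace TypedComplex

variable {V : Type*} {Δ : TypedComplex (Fin 4) V}

/-! ### Simplices and links -/

theorem adj_of_mem_face {s : Finset V} (hs : s ∈ Δ.faces) {x y : V} (hx : x ∈ s) (hy : y ∈ s)
    (h : x ≠ y) : Δ.graph.Adj x y :=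
  ⟨h, s, hs, hx, hy⟩

theorem type_injOn {s : Finset V} (hs : s ∈ Δ.faces) : Set.InjOn Δ.type s := by
  intro x hx y hy h
  by_contra hne
  exact Δ.type_ne x y (adj_of_mem_face hs hx hy hne) h

theorem card_le_four {s : Finset V} (hs : s ∈ Δ.faces) : s.card ≤ 4 := by
  have := Finset.card_le_card_of_injOn (t := Finset.univ) Δ.type (by simp) (type_injOn hs)
  simpa using this

/-- Types are injective on a simplex, so simplices have at most four vertices and enlarging must
stop. -/
theorem exists_maximal_face {s : Finset V} (hs : s ∈ Δ.faces) :
    ∃ t, s ⊆ t ∧ Maximal (· ∈ Δ.faces) t := by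
  induction hn : 4 - s.card generalizing s with
  | zero =>
    refine ⟨s, subset_rfl, hs, fun t ht hst => ?_⟩
    have := card_le_four ht
    exact (Finset.eq_of_subset_of_card_le hst (by omega)).ge
  | succ n ih =>
    by_cases hm : Maximal (· ∈ Δ.faces) s
    · exact ⟨s, subset_rfl, hm⟩
    · obtain ⟨t, ht, hst, hts⟩ : ∃ t ∈ Δ.faces, s ⊆ t ∧ ¬ t ⊆ s := by
        by_contra! hcon
        exact hm ⟨hs, fun t ht hst => hcon t ht hst⟩
      have hlt := Finset.card_lt_card (Finset.ssubset_iff_subset_ne.2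
        ⟨hst, fun h => hts h.ge⟩)
      have hle := card_le_four ht
      -- pass to a subset of `t` with one more vertex than `s`
      obtain ⟨r, hsr, hrt, hr⟩ := Finset.exists_subsuperset_card_eq hst
        (Nat.le_succ s.card) hlt
      have hrf : r ∈ Δ.faces := (Δ.isRelLowerSet_faces ht).2 hrt
        (Finset.card_pos.1 (by omega))
      obtain ⟨u, hru, hu⟩ := ih hrf (by omega)
      exact ⟨u, hsr.trans hru, hu⟩

/-- Every simplex is contained in a simplex having a vertex of each type. -/
theorem exists_face_of_types {s : Finset V} (hs : s ∈ Δ.faces) :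
    ∃ t ∈ Δ.faces, s ⊆ t ∧ ∀ i, ∃ x ∈ t, Δ.type x = i := by
  obtain ⟨t, hst, ht⟩ := exists_maximal_face hs
  refine ⟨t, ht.1, hst, fun i => ?_⟩
  have hc := Δ.card_of_maximal t ht
  obtain ⟨x, hx, h⟩ := Finset.surj_on_of_inj_on_of_card_le (s := t) (t := Finset.univ)
    (fun x _ => Δ.type x) (by simp)
    (fun x y hx hy h => type_injOn ht.1 hx hy h) (by simp [hc]) i (Finset.mem_univ i)
  exact ⟨x, hx, h.symm⟩

theorem mem_vertexSet_lk {x d : V} : x ∈ vertexSet (Δ.lk d) ↔ Δ.graph.Adj x d := by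
  constructor
  · rintro ⟨-, hd, hf⟩
    refine adj_of_mem_face hf (by simp) (by simp) ?_
    rintro rfl
    simp at hd
  · rintro ⟨hne, s, hs, hx, hd⟩
    refine ⟨Finset.singleton_nonempty x, by simpa using hne.symm,
      (Δ.isRelLowerSet_faces hs).2 ?_ (Finset.cons_nonempty _)⟩
    intro y hy
    simp only [Finset.mem_cons, Finset.mem_singleton] at hy
    rcases hy with rfl | rfl
    exacts [hd, hx]

/-- By flagness an edge between two neighbours of `d` spans a simplex with `d`. Hence the link has
the induced subgraph as its skeleton, and inducedness of cycles can be tested in `Δ` itself. -/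
theorem skeleton_lk_adj (hΔ : IsFlag Δ.toPreAbstractSimplicialComplex) {x y d : V} :
    (skeleton (Δ.lk d)).Adj x y ↔ Δ.graph.Adj x y ∧ Δ.graph.Adj x d ∧ Δ.graph.Adj y d := by
  classical
  constructor
  · rintro ⟨hne, s, ⟨-, hd, hf⟩, hx, hy⟩
    refine ⟨adj_of_mem_face hf (by simp [hx]) (by simp [hy]) hne,
      adj_of_mem_face hf (by simp [hx]) (by simp) ?_,
      adj_of_mem_face hf (by simp [hy]) (by simp) ?_⟩
    · rintro rfl
      exact hd hx
    · rintro rfl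
      exact hd hy
  · rintro ⟨hxy, hx, hy⟩
    refine ⟨hxy.ne, {x, y}, ⟨by simp, by simp [hx.ne', hy.ne'],
      hΔ _ (Finset.cons_nonempty _) ?_⟩, by simp, by simp⟩
    intro u hu v hv huv
    simp only [Finset.mem_cons, Finset.mem_insert, Finset.mem_singleton] at hu hv
    change Δ.graph.Adj u v
    rcases hu with rfl | rfl | rfl <;> rcases hv with rfl | rfl | rfl <;>
      first
        | exact absurd rfl huv | exact hxy | exact hx | exact hy
        | exact hxy.symm | exact hx.symm | exact hy.symm

end TypedComplex

/-! ### The local conditions in terms of the order -/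

/-- The relation `<` on the vertices of a graph with types. -/
def RankLt {V : Type*} (G : SimpleGraph V) (ty : V → Fin 4) (x y : V) : Prop :=
  G.Adj x y ∧ ty x < ty y

/-- The reflexive closure of `RankLt`. -/
def RankLe {V : Type*} (G : SimpleGraph V) (ty : V → Fin 4) (x y : V) : Prop :=
  x = y ∨ RankLt G ty x y

/-- Those properties of the `1`-skeleton of a 353-simplicial complex that concern the links of
vertices. -/
structure Is353Graph {V : Type*} (G : SimpleGraph V) (ty : V → Fin 4) : Prop where
  ty_ne : ∀ x y, G.Adj x y → ty x ≠ ty y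
  trans : ∀ x y z, RankLt G ty x y → RankLt G ty y z → RankLt G ty x z
  exists_between : ∀ x y i, RankLt G ty x y → ty x < i → i < ty y →
    ∃ z, ty z = i ∧ RankLt G ty x z ∧ RankLt G ty z y
  bowtie_d : ∀ d, ty d = 3 → ∀ x₁ x₂ y₁ y₂, x₁ ≠ x₂ → y₁ ≠ y₂ →
    RankLt G ty x₁ y₁ → RankLt G ty x₁ y₂ → RankLt G ty x₂ y₁ → RankLt G ty x₂ y₂ →
    RankLt G ty y₁ d → RankLt G ty y₂ d →
    ∃ z, RankLe G ty x₁ z ∧ RankLe G ty x₂ z ∧ RankLe G ty z y₁ ∧ RankLe G ty z y₂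
  bowtie_a : ∀ a, ty a = 0 → ∀ x₁ x₂ y₁ y₂, x₁ ≠ x₂ → y₁ ≠ y₂ →
    RankLt G ty x₁ y₁ → RankLt G ty x₁ y₂ → RankLt G ty x₂ y₁ → RankLt G ty x₂ y₂ →
    RankLt G ty a x₁ → RankLt G ty a x₂ →
    ∃ z, RankLe G ty x₁ z ∧ RankLe G ty x₂ z ∧ RankLe G ty z y₁ ∧ RankLe G ty z y₂
  flag_d : ∀ d, ty d = 3 → ∀ x y z u v w, RankLt G ty x u → RankLt G ty y u →
    RankLt G ty y v → RankLt G ty z v → RankLt G ty x w → RankLt G ty z w →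
    RankLt G ty u d → RankLt G ty v d → RankLt G ty w d →
    ∃ t, RankLt G ty t d ∧ RankLe G ty x t ∧ RankLe G ty y t ∧ RankLe G ty z t
  flag_a : ∀ a, ty a = 0 → ∀ x y z u v w, RankLt G ty u x → RankLt G ty u y →
    RankLt G ty v y → RankLt G ty v z → RankLt G ty w x → RankLt G ty w z →
    RankLt G ty a u → RankLt G ty a v → RankLt G ty a w →
    ∃ t, RankLt G ty a t ∧ RankLe G ty t x ∧ RankLe G ty t y ∧ RankLe G ty t z
  eight_d : ∀ d, ty d = 3 → ∀ w : Fin 8 → V, (∀ i, G.Adj (w i) d) →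
    (∀ i, ty (w i) = ![0, 2, 0, 2, 0, 2, 1, 2] i) → ¬ IsInducedCycle G w
  eight_a : ∀ a, ty a = 0 → ∀ w : Fin 8 → V, (∀ i, G.Adj (w i) a) →
    (∀ i, ty (w i) = ![3, 1, 3, 1, 3, 1, 2, 1] i) → ¬ IsInducedCycle G w
  ten_d : ∀ d, ty d = 3 → ∀ w : Fin 10 → V, (∀ i, G.Adj (w i) d) →
    (∀ i, ty (w i) = ![2, 1, 2, 0, 2, 1, 2, 1, 2, 0] i) → IsInducedCycle G w →
    ∃ a, G.Adj a d ∧ ty a = 0 ∧ ∀ i, ty (w i) = 1 → G.Adj a (w i)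
  ten_a : ∀ a, ty a = 0 → ∀ w : Fin 10 → V, (∀ i, G.Adj (w i) a) →
    (∀ i, ty (w i) = ![1, 2, 1, 3, 1, 2, 1, 2, 1, 3] i) → IsInducedCycle G w →
    ∃ d, G.Adj d a ∧ ty d = 3 ∧ ∀ i, ty (w i) = 2 → G.Adj d (w i)

theorem rankLt_rev {V : Type*} {G : SimpleGraph V} {ty : V → Fin 4} {x y : V} :
    RankLt G (fun v => (ty v).rev) x y ↔ RankLt G ty y x := by
  simp [RankLt, G.adj_comm x y]

theorem rankLe_rev {V : Type*} {G : SimpleGraph V} {ty : V → Fin 4} {x y : V} :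
    RankLe G (fun v => (ty v).rev) x y ↔ RankLe G ty y x := by
  simp [RankLe, rankLt_rev, eq_comm]

namespace Is353Graph

variable {V : Type*} {G : SimpleGraph V} {ty : V → Fin 4}

/-- Reversing the order of the types. -/
theorem dual (h : Is353Graph G ty) : Is353Graph G (fun v => (ty v).rev) := by
  have r3 : ∀ i : Fin 4, i.rev = 3 ↔ i = 0 := by decide
  have r0 : ∀ i : Fin 4, i.rev = 0 ↔ i = 3 := by decide
  have r1 : ∀ i : Fin 4, i.rev = 1 ↔ i = 2 := by decide
  have r2 : ∀ i : Fin 4, i.rev = 2 ↔ i = 1 := by decide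
  have rr : ∀ i j : Fin 4, i.rev = j ↔ i = j.rev := by decide
  have rlt : ∀ i j : Fin 4, i.rev < j ↔ j.rev < i := by decide
  have ltr : ∀ i j : Fin 4, i < j.rev ↔ j < i.rev := by decide
  constructor
  · intro x y hxy
    simpa using h.ty_ne x y hxy
  · simp only [rankLt_rev]
    exact fun x y z h₁ h₂ => h.trans z y x h₂ h₁
  · simp only [rankLt_rev]
    intro x y i hxy hi hi'
    obtain ⟨z, hz, h₁, h₂⟩ := h.exists_between y x i.rev hxy ((ltr _ _).1 hi')
      ((rlt _ _).1 hi)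
    exact ⟨z, (rr _ _).2 hz, h₂, h₁⟩
  · simp only [rankLt_rev, rankLe_rev, r3]
    intro a ha x₁ x₂ y₁ y₂ hx hy h₁ h₂ h₃ h₄ h₅ h₆
    obtain ⟨z, k₁, k₂, k₃, k₄⟩ := h.bowtie_a a ha y₁ y₂ x₁ x₂ hy hx h₁ h₃ h₂ h₄ h₅ h₆
    exact ⟨z, k₃, k₄, k₁, k₂⟩
  · simp only [rankLt_rev, rankLe_rev, r0]
    intro a ha x₁ x₂ y₁ y₂ hx hy h₁ h₂ h₃ h₄ h₅ h₆
    obtain ⟨z, k₁, k₂, k₃, k₄⟩ := h.bowtie_d a ha y₁ y₂ x₁ x₂ hy hx h₁ h₃ h₂ h₄ h₅ h₆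
    exact ⟨z, k₃, k₄, k₁, k₂⟩
  · simpa only [rankLt_rev, rankLe_rev, r3] using h.flag_a
  · simpa only [rankLt_rev, rankLe_rev, r0] using h.flag_d
  · simp only [r3, rr]
    intro d hd w hw ht
    -- Reversal of types exchanges the two patterns of 8-cycles, and likewise the two patterns of
    -- 10-cycles below.
    exact h.eight_a d hd w hw fun i => by rw [ht i]; fin_cases i <;> rfl
  · simp only [r0, rr]
    intro d hd w hw ht
    exact h.eight_d d hd w hw fun i => by rw [ht i]; fin_cases i <;> rfl
  · simp only [r3, r0, r1, rr _ (Matrix.vecCons _ _ _)]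
    intro d hd w hw ht
    exact h.ten_a d hd w hw fun i => by rw [ht i]; fin_cases i <;> rfl
  · simp only [r3, r0, r2, rr _ (Matrix.vecCons _ _ _)]
    intro d hd w hw ht
    exact h.ten_d d hd w hw fun i => by rw [ht i]; fin_cases i <;> rfl

end Is353Graph

/-- Transitivity puts everything below an element of the link of `d`, or above an element of the
link of `a`, into that link, so link membership reduces to a few comparabilities. Intermediate types
come from completing an edge to a simplex with all four types. -/
theorem Is353Simplicial.is353Graph {V : Type*} {Δ : TypedComplex (Fin 4) V}
    (h : Is353Simplicial Δ) : Is353Graph Δ.graph Δ.type := by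
  have htrans : ∀ x y z, Δ.lt x y → Δ.lt y z → Δ.lt x z := h.order.trans
  have hne : ∀ {x y}, Δ.lt x y → x ≠ y := fun hxy => hxy.1.ne
  have hmem : ∀ {x d}, Δ.graph.Adj x d → x ∈ vertexSet (Δ.lk d) :=
    fun hx => TypedComplex.mem_vertexSet_lk.2 hx
  have hlt3 : ∀ {x d}, Δ.type d = 3 → Δ.graph.Adj x d → Δ.lt x d := fun {x d} hd hx =>
    ⟨hx, lt_of_le_of_ne (by rw [hd]; exact Fin.le_last _) (Δ.type_ne x d hx)⟩
  have hlt0 : ∀ {x a}, Δ.type a = 0 → Δ.graph.Adj x a → Δ.lt a x := fun {x d} hd hx =>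
    ⟨hx.symm, lt_of_le_of_ne (by rw [hd]; exact Fin.zero_le _) (Δ.type_ne d x hx.symm)⟩
  have hcyc : ∀ {n : ℕ} [NeZero n] (w : Fin n → V) (d : V), (∀ i, Δ.graph.Adj (w i) d) →
      IsInducedCycle Δ.graph w → IsInducedCycle (skeleton (Δ.lk d)) w := by
    intro n _ w d hw ⟨h₁, h₂, h₃⟩
    exact ⟨h₁, fun i => (TypedComplex.skeleton_lk_adj h.flag).2 ⟨h₂ i, hw _, hw _⟩,
      fun i j hij => h₃ i j ((TypedComplex.skeleton_lk_adj h.flag).1 hij).1⟩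
  refine ⟨Δ.type_ne, htrans, ?_, ?_, ?_, ?_, ?_, ?_, ?_, ?_, ?_⟩
  · rintro x y i ⟨⟨hxy, s, hs, hx, hy⟩, -⟩ hi hi'
    obtain ⟨t, ht, hst, hall⟩ := TypedComplex.exists_face_of_types hs
    obtain ⟨z, hz, rfl⟩ := hall i
    exact ⟨z, rfl, ⟨TypedComplex.adj_of_mem_face ht (hst hx) hz (by rintro rfl; exact hi.ne rfl),
      hi⟩, TypedComplex.adj_of_mem_face ht hz (hst hy) (by rintro rfl; exact hi'.ne rfl), hi'⟩
  · intro d hd x₁ x₂ y₁ y₂ hx hy h₁ h₂ h₃ h₄ h₅ h₆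
    obtain ⟨z, -, k₁, k₂, k₃, k₄⟩ := h.bowtie_d d hd x₁ (hmem (htrans _ _ _ h₁ h₅).1)
      y₁ (hmem h₅.1) x₂ (hmem (htrans _ _ _ h₃ h₅).1) y₂ (hmem h₆.1)
      (by simp [hx, hy, hne h₁, hne h₂, (hne h₃).symm, hne h₄]) (.inr h₁) (.inr h₂) (.inr h₃)
      (.inr h₄)
    exact ⟨z, k₁, k₂, k₃, k₄⟩
  · intro a ha x₁ x₂ y₁ y₂ hx hy h₁ h₂ h₃ h₄ h₅ h₆
    obtain ⟨z, -, k₁, k₂, k₃, k₄⟩ := h.bowtie_a a ha x₁ (hmem h₅.1.symm)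
      y₁ (hmem (htrans _ _ _ h₅ h₁).1.symm) x₂ (hmem h₆.1.symm)
      y₂ (hmem (htrans _ _ _ h₅ h₂).1.symm)
      (by simp [hx, hy, hne h₁, hne h₂, (hne h₃).symm, hne h₄]) (.inr h₁) (.inr h₂) (.inr h₃)
      (.inr h₄)
    exact ⟨z, k₁, k₂, k₃, k₄⟩
  · intro d hd x y z u v w h₁ h₂ h₃ h₄ h₅ h₆ h₇ h₈ h₉
    obtain ⟨t, ht, k⟩ := h.flag_d d hd x (hmem (htrans _ _ _ h₁ h₇).1)
      y (hmem (htrans _ _ _ h₂ h₇).1) z (hmem (htrans _ _ _ h₄ h₈).1)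
      ⟨u, hmem h₇.1, .inr h₁, .inr h₂⟩ ⟨v, hmem h₈.1, .inr h₃, .inr h₄⟩
      ⟨w, hmem h₉.1, .inr h₅, .inr h₆⟩
    exact ⟨t, hlt3 hd (TypedComplex.mem_vertexSet_lk.1 ht), k⟩
  · intro d hd x y z u v w h₁ h₂ h₃ h₄ h₅ h₆ h₇ h₈ h₉
    obtain ⟨t, ht, k⟩ := h.flag_a d hd x (hmem (htrans _ _ _ h₇ h₁).1.symm)
      y (hmem (htrans _ _ _ h₇ h₂).1.symm) z (hmem (htrans _ _ _ h₈ h₄).1.symm)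
      ⟨u, hmem h₇.1.symm, .inr h₁, .inr h₂⟩ ⟨v, hmem h₈.1.symm, .inr h₃, .inr h₄⟩
      ⟨w, hmem h₉.1.symm, .inr h₅, .inr h₆⟩
    exact ⟨t, hlt0 hd (TypedComplex.mem_vertexSet_lk.1 ht), k⟩
  · exact fun d hd w hw ht hc => h.eight_d d hd w ht (hcyc w d hw hc)
  · exact fun d hd w hw ht hc => h.eight_a d hd w ht (hcyc w d hw hc)
  · intro d hd w hw ht hc
    obtain ⟨a, ha, k⟩ := h.ten_d d hd w ht (hcyc w d hw hc)
    exact ⟨a, TypedComplex.mem_vertexSet_lk.1 ha, k⟩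
  · intro d hd w hw ht hc
    obtain ⟨a, ha, k⟩ := h.ten_a d hd w ht (hcyc w d hw hc)
    exact ⟨a, TypedComplex.mem_vertexSet_lk.1 ha, k⟩

/-- The `4`-cycle `x y z t` is embedded and has a common neighbour. -/
def IsConedSquare {V : Type*} (G : SimpleGraph V) (x y z t : V) : Prop :=
  (G.Adj x y ∧ G.Adj y z ∧ G.Adj z t ∧ G.Adj t x ∧ x ≠ z ∧ y ≠ t) ∧
    ∃ v : V, G.Adj v x ∧ G.Adj v y ∧ G.Adj v z ∧ G.Adj v t

theorem IsConedSquare.rotate {V : Type*} {G : SimpleGraph V} {x y z t : V}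
    (h : IsConedSquare G x y z t) : IsConedSquare G y z t x := by
  obtain ⟨⟨h1, h2, h3, h4, h5, h6⟩, v, v1, v2, v3, v4⟩ := h
  exact ⟨⟨h2, h3, h4, h1, h6, h5.symm⟩, v, v2, v3, v4, v1⟩

/-! ### Meets, joins and hexagons in links -/

namespace Is353Graph

variable {V : Type*} {G : SimpleGraph V} {ty : V → Fin 4}

local infix:50 " ≺ " => RankLt G ty
local infix:50 " ≼ " => RankLe G ty

theorem _root_.ThreeFiveThree.RankLe.eq_of_type_le {x y : V} (h : x ≼ y) (ht : ty y ≤ ty x) :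
    x = y :=
  h.resolve_right fun h => absurd h.2 ht.not_gt

theorem _root_.ThreeFiveThree.RankLe.lt_of_type_lt {x y : V} (h : x ≼ y) (ht : ty x < ty y) :
    x ≺ y :=
  h.resolve_left fun h => ht.ne (congrArg ty h)

theorem _root_.ThreeFiveThree.RankLe.lt_of_ne {x y : V} (h : x ≼ y) (hn : x ≠ y) : x ≺ y :=
  h.resolve_left hn

theorem lt_of_lt_of_le (h : Is353Graph G ty) {x y z : V} (hxy : x ≺ y) (hyz : y ≼ z) :
    x ≺ z := by
  rcases hyz with rfl | hyz
  exacts [hxy, h.trans _ _ _ hxy hyz]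

theorem lt_of_le_of_lt (h : Is353Graph G ty) {x y z : V} (hxy : x ≼ y) (hyz : y ≺ z) :
    x ≺ z := by
  rcases hxy with rfl | hxy
  exacts [hyz, h.trans _ _ _ hxy hyz]

theorem lt_of_adj (h : Is353Graph G ty) {x y : V} (hxy : G.Adj x y) : x ≺ y ∨ y ≺ x :=
  (lt_or_gt_of_ne (h.ty_ne x y hxy)).imp (fun k => ⟨hxy, k⟩) fun k => ⟨hxy.symm, k⟩

theorem lt_of_adj_top (h : Is353Graph G ty) {x d : V} (hd : ty d = 3) (hx : G.Adj x d) :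
    x ≺ d :=
  ⟨hx, lt_of_le_of_ne (by rw [hd]; exact Fin.le_last _) (h.ty_ne x d hx)⟩

theorem lt_of_adj_bot (h : Is353Graph G ty) {a x : V} (ha : ty a = 0) (hx : G.Adj a x) :
    a ≺ x :=
  ⟨hx, lt_of_le_of_ne (by rw [ha]; exact Fin.zero_le _) (h.ty_ne a x hx)⟩

/-- A common neighbour lies above the type 0 vertices and below the type 3 vertices; conversely
transitivity through `v` supplies the four edges. -/
theorem isConedSquare_iff (h : Is353Graph G ty) {a d a' d' : V} (ha : ty a = 0)
    (ha' : ty a' = 0) (hd : ty d = 3) (hd' : ty d' = 3) :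
    IsConedSquare G a d a' d' ↔
      a ≠ a' ∧ d ≠ d' ∧ ∃ v, a ≺ v ∧ a' ≺ v ∧ v ≺ d ∧ v ≺ d' := by
  constructor
  · rintro ⟨⟨-, -, -, -, h5, h6⟩, v, v1, v2, v3, v4⟩
    exact ⟨h5, h6, v, h.lt_of_adj_bot ha v1.symm, h.lt_of_adj_bot ha' v3.symm,
      h.lt_of_adj_top hd v2, h.lt_of_adj_top hd' v4⟩
  · rintro ⟨h5, h6, v, v1, v2, v3, v4⟩
    exact ⟨⟨(h.trans _ _ _ v1 v3).1, (h.trans _ _ _ v2 v3).1.symm, (h.trans _ _ _ v2 v4).1,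
      (h.trans _ _ _ v1 v4).1.symm, h5, h6⟩, v, v1.1.symm, v3.1, v2.1.symm, v4.1⟩

theorem type_eq_one {i : Fin 4} (h₀ : 0 < i) (h₂ : i < 2) : i = 1 := by
  revert i; decide

theorem type_eq_one_or_two {i : Fin 4} (h₀ : 0 < i) (h₃ : i < 3) : i = 1 ∨ i = 2 := by
  revert i; decide

/-- Below a vertex of type `3`, every vertex of type at most `2` is below one of type `2`. -/
theorem exists_type_two (h : Is353Graph G ty) {v d : V} (hd : ty d = 3) (hv : v ≺ d)
    (hv₀ : 0 < ty v) : ∃ c, ty c = 2 ∧ v ≼ c ∧ c ≺ d := by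
  rcases type_eq_one_or_two hv₀ (hd ▸ hv.2) with h1 | h2
  · obtain ⟨c, hc, hvc, hcd⟩ := h.exists_between v d 2 hv (by rw [h1]; decide)
      (by rw [hd]; decide)
    exact ⟨c, hc, .inr hvc, hcd⟩
  · exact ⟨v, h2, .inl rfl, hv⟩

/-- Otherwise `c, c', d, d'` is a bowtie in the link of `a`, and no type is left strictly between 2
and 3. Thus a square has at most one cone point of type 2. -/
theorem eq_of_type_two (h : Is353Graph G ty) {a c c' d d' : V} (ha : ty a = 0) (hc : ty c = 2)
    (hc' : ty c' = 2) (hd : ty d = 3) (hd' : ty d' = 3) (hac : a ≺ c) (hac' : a ≺ c')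
    (hcd : c ≺ d) (hcd' : c ≺ d') (hc'd : c' ≺ d) (hc'd' : c' ≺ d') (hdd : d ≠ d') :
    c = c' := by
  by_contra hne
  obtain ⟨z, h1, h2, h3, h4⟩ := h.bowtie_a a ha c c' d d' hne hdd hcd hcd' hc'd hc'd' hac hac'
  have hcz : c ≠ z := by
    rintro rfl
    exact hne (h2.eq_of_type_le (by rw [hc, hc'])).symm
  have hz := (h1.lt_of_ne hcz).2
  rw [hc] at hz
  have hz3 : ty z = 3 := by
    revert hz
    generalize ty z = i
    revert i
    decide
  exact hdd ((h3.eq_of_type_le (by rw [hd, hz3])).symm.trans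
    (h4.eq_of_type_le (by rw [hd', hz3])))

/-- In the link of `d`, the vertex `b` is the meet of `c` and `c'`: the element `z` given by bowtie
freeness has type at most 1 and lies above `b`, so it is `b`. -/
theorem le_of_le_two (h : Is353Graph G ty) {b x c c' d : V} (hd : ty d = 3) (hb : ty b = 1)
    (hc : ty c = 2) (hc' : ty c' = 2) (hne : c ≠ c') (hbc : b ≺ c) (hbc' : b ≺ c')
    (hxc : x ≺ c) (hxc' : x ≺ c') (hcd : c ≺ d) (hcd' : c' ≺ d) : x ≼ b := by
  by_cases hxb : x = b
  · exact .inl hxb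
  obtain ⟨z, h1, h2, h3, h4⟩ := h.bowtie_d d hd x b c c' hxb hne hxc hxc' hbc hbc' hcd hcd'
  have hzc : z ≠ c := by
    rintro rfl
    exact hne (h4.eq_of_type_le (by rw [hc, hc']))
  have hz := (h3.lt_of_ne hzc).2
  have : b = z := by
    refine h2.eq_of_type_le ?_
    rw [hb]
    rw [hc] at hz
    revert hz
    generalize ty z = i
    revert i
    decide
  exact this ▸ h1

theorem lt_of_lt_two (h : Is353Graph G ty) {b x c c' d : V} (hd : ty d = 3) (hb : ty b = 1)
    (hx : ty x = 0) (hc : ty c = 2) (hc' : ty c' = 2) (hne : c ≠ c') (hbc : b ≺ c)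
    (hbc' : b ≺ c') (hxc : x ≺ c) (hxc' : x ≺ c') (hcd : c ≺ d) (hcd' : c' ≺ d) : x ≺ b :=
  (h.le_of_le_two hd hb hc hc' hne hbc hbc' hxc hxc' hcd hcd').lt_of_type_lt
    (by rw [hx, hb]; decide)

theorem eq_of_lt_two (h : Is353Graph G ty) {b b' c c' d : V} (hd : ty d = 3) (hb : ty b = 1)
    (hb' : ty b' = 1) (hc : ty c = 2) (hc' : ty c' = 2) (hne : c ≠ c') (hbc : b ≺ c)
    (hbc' : b ≺ c') (hxc : b' ≺ c) (hxc' : b' ≺ c') (hcd : c ≺ d) (hcd' : c' ≺ d) : b' = b :=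
  (h.le_of_le_two hd hb hc hc' hne hbc hbc' hxc hxc' hcd hcd').eq_of_type_le (by rw [hb, hb'])

/-- Bowtie freeness gives an intermediate element; it differs from all four vertices because equal
types are incomparable, so only type 1 remains. -/
theorem exists_type_one (h : Is353Graph G ty) {x y c c' d : V} (hd : ty d = 3) (hx : ty x = 0)
    (hy : ty y = 0) (hc : ty c = 2) (hc' : ty c' = 2) (hxy : x ≠ y) (hne : c ≠ c')
    (hxc : x ≺ c) (hxc' : x ≺ c') (hyc : y ≺ c) (hyc' : y ≺ c') (hcd : c ≺ d) (hcd' : c' ≺ d) :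
    ∃ b, ty b = 1 ∧ x ≺ b ∧ y ≺ b ∧ b ≺ c ∧ b ≺ c' := by
  obtain ⟨z, h1, h2, h3, h4⟩ := h.bowtie_d d hd x y c c' hxy hne hxc hxc' hyc hyc' hcd hcd'
  have hxz : x ≠ z := by
    rintro rfl
    exact hxy (h2.eq_of_type_le (by rw [hx, hy])).symm
  have hyz : y ≠ z := by
    rintro rfl
    exact hxy (h1.eq_of_type_le (by rw [hx, hy]))
  have hzc : z ≠ c := by
    rintro rfl
    exact hne (h4.eq_of_type_le (by rw [hc, hc']))
  have hzc' : z ≠ c' := by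
    rintro rfl
    exact hne (h3.eq_of_type_le (by rw [hc, hc'])).symm
  have k1 := h1.lt_of_ne hxz
  have k3 := h3.lt_of_ne hzc
  exact ⟨z, type_eq_one (hx ▸ k1.2) (hc ▸ k3.2), k1, h2.lt_of_ne hyz, k3, h4.lt_of_ne hzc'⟩

/-- The link of an edge of type `{0, 3}` contains no hexagon. -/
theorem no_hexagon (h : Is353Graph G ty) {a b₁ b₂ b₃ c₁ c₂ c₃ d : V} (ha : ty a = 0)
    (hd : ty d = 3) (hb₁ : ty b₁ = 1) (hb₂ : ty b₂ = 1) (hb₃ : ty b₃ = 1) (hc₁ : ty c₁ = 2)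
    (hc₂ : ty c₂ = 2) (hc₃ : ty c₃ = 2) (n₁₂ : c₁ ≠ c₂) (n₁₃ : c₁ ≠ c₃) (n₂₃ : c₂ ≠ c₃)
    (ab₁ : a ≺ b₁) (ab₂ : a ≺ b₂) (ab₃ : a ≺ b₃) (h₁₂ : b₁ ≺ c₂) (h₁₃ : b₁ ≺ c₃)
    (h₂₁ : b₂ ≺ c₁) (h₂₃ : b₂ ≺ c₃) (h₃₁ : b₃ ≺ c₁) (h₃₂ : b₃ ≺ c₂)
    (d₁ : c₁ ≺ d) (d₂ : c₂ ≺ d) (d₃ : c₃ ≺ d) : b₁ = b₂ ∧ b₂ = b₃ := by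
  -- The common lower bound `t` has type 1 and shares two upper bounds `cᵢ` with each `bⱼ`;
  -- uniqueness of meets identifies every `bⱼ` with `t`.
  obtain ⟨t, hat, k₁, k₂, k₃⟩ := h.flag_a a ha c₁ c₂ c₃ b₃ b₁ b₂ h₃₁ h₃₂ h₁₂ h₁₃ h₂₁ h₂₃
    ab₃ ab₁ ab₂
  have ht : t ≺ c₁ := k₁.lt_of_ne <| by
    rintro rfl
    exact n₁₂ (k₂.eq_of_type_le (by rw [hc₁, hc₂]))
  have ht1 : ty t = 1 := type_eq_one (ha ▸ hat.2) (hc₁ ▸ ht.2)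
  have ht' : ∀ {c}, ty c = 2 → t ≼ c → t ≺ c := fun hc k =>
    k.lt_of_type_lt (by rw [hc, ht1]; decide)
  have e₁ := h.eq_of_lt_two hd ht1 hb₁ hc₂ hc₃ n₂₃ (ht' hc₂ k₂) (ht' hc₃ k₃) h₁₂ h₁₃ d₂ d₃
  have e₂ := h.eq_of_lt_two hd ht1 hb₂ hc₁ hc₃ n₁₃ ht (ht' hc₃ k₃) h₂₁ h₂₃ d₁ d₃
  have e₃ := h.eq_of_lt_two hd ht1 hb₃ hc₁ hc₂ n₁₂ ht (ht' hc₂ k₂) h₃₁ h₃₂ d₁ d₂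
  exact ⟨e₁.trans e₂.symm, e₂.trans e₃.symm⟩

/-- The pairs `a, x`, `a, y` and `x, y` are bounded by `c₁`, `c₂` and `v`, so upward flagness gives
a common upper bound, which can be raised to some `u` of type 2. If `u` is `c₁` or `c₂`, then `y` or
`x` is below both `cᵢ`, hence below their meet `b`. Otherwise the meets of the pairs among `c₁, c₂,
u` form a hexagon in the link of the edge `a d`, so they coincide. -/
theorem lt_or_lt_of_bounded (h : Is353Graph G ty) {a b c₁ c₂ d x y v : V} (ha : ty a = 0)
    (hb : ty b = 1) (hc₁ : ty c₁ = 2) (hc₂ : ty c₂ = 2) (hd : ty d = 3) (hx : ty x = 0)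
    (hy : ty y = 0) (ab : a ≺ b) (bc₁ : b ≺ c₁) (bc₂ : b ≺ c₂) (cd₁ : c₁ ≺ d) (cd₂ : c₂ ≺ d)
    (hne : c₁ ≠ c₂) (xc : x ≺ c₁) (yc : y ≺ c₂) (xv : x ≺ v) (yv : y ≺ v) (vd : v ≺ d) :
    x ≺ b ∨ y ≺ b := by
  by_cases hax : a = x
  · exact .inl (hax ▸ ab)
  by_cases hay : a = y
  · exact .inr (hay ▸ ab)
  have ac₁ := h.trans _ _ _ ab bc₁
  have ac₂ := h.trans _ _ _ ab bc₂
  obtain ⟨t, td, at', xt, yt⟩ := h.flag_d d hd a x y c₁ v c₂ ac₁ xc xv yv ac₂ yc cd₁ vd cd₂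
  have at'' : a ≺ t := at'.lt_of_ne <| by
    rintro rfl
    exact hax (xt.eq_of_type_le (by rw [ha, hx])).symm
  obtain ⟨u, hu, tu, ud⟩ := h.exists_type_two hd td (ha ▸ at''.2)
  have au := h.lt_of_lt_of_le at'' tu
  have xt' : x ≺ t := xt.lt_of_type_lt (by rw [hx, ← ha]; exact at''.2)
  have yt' : y ≺ t := yt.lt_of_type_lt (by rw [hy, ← ha]; exact at''.2)
  have xu := h.lt_of_lt_of_le xt' tu
  have yu := h.lt_of_lt_of_le yt' tu
  by_cases hu₁ : c₁ = u
  · exact .inr (h.lt_of_lt_two hd hb hy hc₁ hc₂ hne bc₁ bc₂ (hu₁ ▸ yu) yc cd₁ cd₂)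
  by_cases hu₂ : c₂ = u
  · exact .inl (h.lt_of_lt_two hd hb hx hc₁ hc₂ hne bc₁ bc₂ xc (hu₂ ▸ xu) cd₁ cd₂)
  obtain ⟨b₁, hb₁, ab₁, xb₁, b₁c₁, b₁u⟩ := h.exists_type_one hd ha hx hc₁ hu hax hu₁ ac₁ au xc xu
    cd₁ ud
  obtain ⟨b₂, hb₂, ab₂, yb₂, b₂c₂, b₂u⟩ := h.exists_type_one hd ha hy hc₂ hu hay hu₂ ac₂ au yc yu
    cd₂ ud
  obtain ⟨e₁, e₂⟩ := h.no_hexagon ha hd hb₂ hb₁ hb hc₁ hc₂ hu hne hu₁ hu₂ ab₂ ab₁ ab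
    b₂c₂ b₂u b₁c₁ b₁u bc₁ bc₂ cd₁ cd₂ ud
  exact .inl (e₂ ▸ xb₁)

end Is353Graph

/-! ### The cone structure of an unfilled corner -/

/-- A cube corner with centre `a` of type `0` whose boundary cannot be cut along a diagonal. -/
structure IsUnfilledCorner {V : Type*} (G : SimpleGraph V) (ty : V → Fin 4)
    (a x₁ x₂ x₃ y₁ y₂ y₃ : V) : Prop where
  center : ty a = 0
  top₁ : ty x₁ = 3
  top₂ : ty x₂ = 3
  top₃ : ty x₃ = 3
  bot₁ : ty y₁ = 0
  bot₂ : ty y₂ = 0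
  bot₃ : ty y₃ = 0
  sq₁ : IsConedSquare G a x₂ y₁ x₃
  sq₂ : IsConedSquare G a x₃ y₂ x₁
  sq₃ : IsConedSquare G a x₁ y₃ x₂
  unfilled₁ : ¬ ((y₁ = y₃ ∨ IsConedSquare G x₁ y₃ x₂ y₁) ∧ (y₁ = y₂ ∨ IsConedSquare G x₁ y₁ x₃ y₂))
  unfilled₂ : ¬ ((y₂ = y₁ ∨ IsConedSquare G x₂ y₁ x₃ y₂) ∧ (y₂ = y₃ ∨ IsConedSquare G x₂ y₂ x₁ y₃))
  unfilled₃ : ¬ ((y₃ = y₂ ∨ IsConedSquare G x₃ y₂ x₁ y₃) ∧ (y₃ = y₁ ∨ IsConedSquare G x₃ y₃ x₂ y₁))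

/-- The cone points of the squares of an unfilled cube corner, together with a common lower bound
`b` of them and of `x₁, x₂, x₃`. -/
structure CornerCone {V : Type*} (G : SimpleGraph V) (ty : V → Fin 4)
    (a x₁ x₂ x₃ y₁ y₂ y₃ b c₁ c₂ c₃ : V) : Prop where
  type_b : ty b = 1
  type₁ : ty c₁ = 2
  type₂ : ty c₂ = 2
  type₃ : ty c₃ = 2
  center_lt : RankLt G ty a b
  lt₁ : RankLt G ty b c₁
  lt₂ : RankLt G ty b c₂
  lt₃ : RankLt G ty b c₃
  lt₁₂ : RankLt G ty c₁ x₂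
  lt₁₃ : RankLt G ty c₁ x₃
  lt₂₁ : RankLt G ty c₂ x₁
  lt₂₃ : RankLt G ty c₂ x₃
  lt₃₁ : RankLt G ty c₃ x₁
  lt₃₂ : RankLt G ty c₃ x₂
  bot_lt₁ : RankLt G ty y₁ c₁
  bot_lt₂ : RankLt G ty y₂ c₂
  bot_lt₃ : RankLt G ty y₃ c₃
  not_lt₁ : ¬ RankLt G ty y₁ b
  not_lt₂ : ¬ RankLt G ty y₂ b
  not_lt₃ : ¬ RankLt G ty y₃ b
  ne₁₂ : c₁ ≠ c₂
  ne₁₃ : c₁ ≠ c₃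
  ne₂₃ : c₂ ≠ c₃

namespace Is353Graph

variable {V : Type*} {G : SimpleGraph V} {ty : V → Fin 4}

local infix:50 " ≺ " => RankLt G ty
local infix:50 " ≼ " => RankLe G ty

variable {a x₁ x₂ x₃ y₁ y₂ y₃ : V}

theorem _root_.ThreeFiveThree.IsUnfilledCorner.rotate
    (k : IsUnfilledCorner G ty a x₁ x₂ x₃ y₁ y₂ y₃) :
    IsUnfilledCorner G ty a x₂ x₃ x₁ y₂ y₃ y₁ :=
  ⟨k.center, k.top₂, k.top₃, k.top₁, k.bot₂, k.bot₃, k.bot₁, k.sq₂, k.sq₃, k.sq₁, k.unfilled₂,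
    k.unfilled₃, k.unfilled₁⟩

/-- If `y₁` is below the cone points of both squares at `x₁`, these cone off the two halves of the
boundary cut along `x₁ y₁`. -/
theorem not_lt_both (h : Is353Graph G ty) (k : IsUnfilledCorner G ty a x₁ x₂ x₃ y₁ y₂ y₃)
    {z₂ z₃ : V} (h₂ : y₁ ≺ z₂) (h₃ : y₁ ≺ z₃) (k₂ : y₂ ≺ z₂) (k₃ : y₃ ≺ z₃) (l₂₁ : z₂ ≺ x₁)
    (l₂₃ : z₂ ≺ x₃) (l₃₁ : z₃ ≺ x₁) (l₃₂ : z₃ ≺ x₂) : False := by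
  refine k.unfilled₁ ⟨or_iff_not_imp_left.2 fun hn => ?_, or_iff_not_imp_left.2 fun hn => ?_⟩
  · exact ((h.isConedSquare_iff k.bot₃ k.bot₁ k.top₂ k.top₁).2
      ⟨Ne.symm hn, k.sq₃.1.2.2.2.2.2.symm, z₃, k₃, h₃, l₃₂, l₃₁⟩).rotate.rotate.rotate
  · exact ((h.isConedSquare_iff k.bot₁ k.bot₂ k.top₃ k.top₁).2
      ⟨hn, k.sq₂.1.2.2.2.2.2, z₂, h₂, k₂, l₂₃, l₂₁⟩).rotate.rotate.rotate

/-- This is bowtie freeness in the link of `a`; the element obtained is neither `p` nor `q`, since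
these are distinct and of the same type. -/
theorem exists_join (h : Is353Graph G ty) {t v p q : V} (ha : ty a = 0) (hp : ty p = 3)
    (hq : ty q = 3) (hpq : p ≠ q) (at' : a ≺ t) (av : a ≺ v) (tp : t ≺ p) (tq : t ≺ q)
    (vp : v ≺ p) (vq : v ≺ q) : ∃ z, t ≼ z ∧ v ≼ z ∧ z ≺ p ∧ z ≺ q := by
  by_cases htv : t = v
  · exact ⟨t, .inl rfl, .inl htv.symm, tp, tq⟩
  obtain ⟨z, h1, h2, h3, h4⟩ := h.bowtie_a a ha t v p q htv hpq tp tq vp vq at' av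
  refine ⟨z, h1, h2, h3.lt_of_ne ?_, h4.lt_of_ne ?_⟩
  · rintro rfl
    exact hpq (h4.eq_of_type_le (by rw [hp, hq]))
  · rintro rfl
    exact hpq (h3.eq_of_type_le (by rw [hp, hq])).symm

/-- The three cone points are pairwise lower bounds of the `xᵢ` in the link of `a`, so downward
flagness gives `t` below all `xᵢ`. Each cone point is replaced by its join `zᵢ` with `t`. If `t` had
type 2, all `zᵢ` would equal `t` and the corner could be cut, so `t` has type 1 and serves as `b`.
No `yᵢ` is below `t`, again because of a cut, which forces every `zᵢ` to have type 2. -/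
theorem exists_cornerCone (h : Is353Graph G ty)
    (k : IsUnfilledCorner G ty a x₁ x₂ x₃ y₁ y₂ y₃) :
    ∃ b c₁ c₂ c₃, CornerCone G ty a x₁ x₂ x₃ y₁ y₂ y₃ b c₁ c₂ c₃ := by
  have ha := k.center
  obtain ⟨-, n₂₃, v₁, av₁, yv₁, v₁₂, v₁₃⟩ := (h.isConedSquare_iff ha k.bot₁ k.top₂ k.top₃).1 k.sq₁
  obtain ⟨-, n₃₁, v₂, av₂, yv₂, v₂₃, v₂₁⟩ := (h.isConedSquare_iff ha k.bot₂ k.top₃ k.top₁).1 k.sq₂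
  obtain ⟨-, n₁₂, v₃, av₃, yv₃, v₃₁, v₃₂⟩ := (h.isConedSquare_iff ha k.bot₃ k.top₁ k.top₂).1 k.sq₃
  obtain ⟨t, at', t₁, t₂, t₃⟩ := h.flag_a a ha x₁ x₂ x₃ v₃ v₁ v₂ v₃₁ v₃₂ v₁₂ v₁₃ v₂₁ v₂₃
    av₃ av₁ av₂
  replace t₂ := t₂.lt_of_ne <| by
    rintro rfl
    exact n₁₂ (t₁.eq_of_type_le (by rw [k.top₁, k.top₂])).symm
  have ht3 : ty t < 3 := k.top₂ ▸ t₂.2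
  replace t₁ := t₁.lt_of_type_lt (by rwa [k.top₁])
  replace t₃ := t₃.lt_of_type_lt (by rwa [k.top₃])
  obtain ⟨z₁, tz₁, vz₁, z₁₂, z₁₃⟩ := h.exists_join ha k.top₂ k.top₃ n₂₃ at' av₁ t₂ t₃ v₁₂ v₁₃
  obtain ⟨z₂, tz₂, vz₂, z₂₃, z₂₁⟩ := h.exists_join ha k.top₃ k.top₁ n₃₁ at' av₂ t₃ t₁ v₂₃ v₂₁
  obtain ⟨z₃, tz₃, vz₃, z₃₁, z₃₂⟩ := h.exists_join ha k.top₁ k.top₂ n₁₂ at' av₃ t₁ t₂ v₃₁ v₃₂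
  have yz₁ := h.lt_of_lt_of_le yv₁ vz₁
  have yz₂ := h.lt_of_lt_of_le yv₂ vz₂
  have yz₃ := h.lt_of_lt_of_le yv₃ vz₃
  have f₁ : y₁ ≺ z₂ → y₁ ≺ z₃ → False := fun p q =>
    h.not_lt_both k p q yz₂ yz₃ z₂₁ z₂₃ z₃₁ z₃₂
  have f₂ : y₂ ≺ z₃ → y₂ ≺ z₁ → False := fun p q =>
    h.not_lt_both k.rotate p q yz₃ yz₁ z₃₂ z₃₁ z₁₂ z₁₃
  have f₃ : y₃ ≺ z₁ → y₃ ≺ z₂ → False := fun p q =>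
    h.not_lt_both k.rotate.rotate p q yz₁ yz₂ z₁₃ z₁₂ z₂₃ z₂₁
  have hz : ∀ {z x}, ty x = 3 → t ≼ z → z ≺ x → ty z = 1 ∨ ty z = 2 := fun {z x} hx tz zx =>
    type_eq_one_or_two (ha ▸ (h.lt_of_lt_of_le at' tz).2) (hx ▸ zx.2)
  rcases type_eq_one_or_two (ha ▸ at'.2) ht3 with ht | ht
  · have g₁ : ¬ y₁ ≺ t := fun q => f₁ (h.lt_of_lt_of_le q tz₂) (h.lt_of_lt_of_le q tz₃)
    have g₂ : ¬ y₂ ≺ t := fun q => f₂ (h.lt_of_lt_of_le q tz₃) (h.lt_of_lt_of_le q tz₁)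
    have g₃ : ¬ y₃ ≺ t := fun q => f₃ (h.lt_of_lt_of_le q tz₁) (h.lt_of_lt_of_le q tz₂)
    have t1 : ty z₁ = 2 := (hz k.top₂ tz₁ z₁₂).resolve_left fun e =>
      g₁ (by rwa [tz₁.eq_of_type_le (by rw [e, ht])])
    have t2 : ty z₂ = 2 := (hz k.top₃ tz₂ z₂₃).resolve_left fun e =>
      g₂ (by rwa [tz₂.eq_of_type_le (by rw [e, ht])])
    have t3 : ty z₃ = 2 := (hz k.top₁ tz₃ z₃₁).resolve_left fun e =>
      g₃ (by rwa [tz₃.eq_of_type_le (by rw [e, ht])])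
    have tlt : ∀ {z}, ty z = 2 → t ≼ z → t ≺ z := fun hz q =>
      q.lt_of_type_lt (by rw [ht, hz]; decide)
    have az₁ := h.lt_of_lt_of_le at' tz₁
    have az₂ := h.lt_of_lt_of_le at' tz₂
    have az₃ := h.lt_of_lt_of_le at' tz₃
    have uniq : ∀ {z z' x x'}, ty z = 2 → ty z' = 2 → ty x = 3 → ty x' = 3 → t ≼ z → t ≼ z' →
        x ≠ x' → z ≺ x → z ≺ x' → z' ≺ x → z' ≺ x' → z = z' :=
      fun hz hz' hx hx' tz tz' n q₁ q₂ q₃ q₄ => h.eq_of_type_two ha hz hz' hx hx'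
        (h.lt_of_lt_of_le at' tz) (h.lt_of_lt_of_le at' tz') q₁ q₂ q₃ q₄ n
    refine ⟨t, z₁, z₂, z₃, ht, t1, t2, t3, at', tlt t1 tz₁, tlt t2 tz₂, tlt t3 tz₃, z₁₂, z₁₃, z₂₁,
      z₂₃, z₃₁, z₃₂, yz₁, yz₂, yz₃, g₁, g₂, g₃, ?_, ?_, ?_⟩
    -- If two cone points coincide, that vertex is below all three `xᵢ`, so by uniqueness of type 2
    -- cone points the third coincides with it too, and the corner can be cut.
    · rintro rfl
      obtain rfl := uniq t1 t3 k.top₁ k.top₂ tz₁ tz₃ n₁₂ z₂₁ z₁₂ z₃₁ z₃₂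
      exact f₁ yz₁ yz₁
    · rintro rfl
      obtain rfl := uniq t1 t2 k.top₃ k.top₁ tz₁ tz₂ n₃₁ z₁₃ z₃₁ z₂₃ z₂₁
      exact f₁ yz₁ yz₁
    · rintro rfl
      obtain rfl := uniq t2 t1 k.top₂ k.top₃ tz₂ tz₁ n₂₃ z₃₂ z₂₃ z₁₂ z₁₃
      exact f₁ yz₁ yz₁
  · have eq : ∀ {z x}, ty x = 3 → t ≼ z → z ≺ x → t = z := fun {z x} hx tz zx =>
      tz.eq_of_type_le <| by
        rw [ht]
        rcases hz hx tz zx with e | e <;> simp [e]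
    have e₁ := eq k.top₂ tz₁ z₁₂
    have e₂ := eq k.top₃ tz₂ z₂₃
    have e₃ := eq k.top₁ tz₃ z₃₁
    subst e₁ e₂ e₃
    exact (f₁ yz₁ yz₁).elim

/-- By `lt_or_lt_of_bounded` in the link of `x₁`, one of `y₂`, `y₃` would lie below `b`. -/
theorem not_bounded (h : Is353Graph G ty) (k : IsUnfilledCorner G ty a x₁ x₂ x₃ y₁ y₂ y₃)
    {v : V} (h₂ : y₂ ≺ v) (h₃ : y₃ ≺ v) (hv : v ≺ x₁) : False := by
  obtain ⟨b, c₁, c₂, c₃, q⟩ := h.exists_cornerCone k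
  rcases h.lt_or_lt_of_bounded k.center q.type_b q.type₂ q.type₃ k.top₁ k.bot₂ k.bot₃ q.center_lt
    q.lt₂ q.lt₃ q.lt₂₁ q.lt₃₁ q.ne₂₃ q.bot_lt₂ q.bot_lt₃ h₂ h₃ hv with r | r
  exacts [q.not_lt₂ r, q.not_lt₃ r]

/-- The cone points of the two squares form a bowtie with `a, a'` in the link of `d`; an element in
between is below both `d₁` and `d₂`. -/
theorem isConedSquare_trans (h : Is353Graph G ty) {a a' d d₁ d₂ : V} (ha : ty a = 0)
    (ha' : ty a' = 0) (hd : ty d = 3) (hd₁ : ty d₁ = 3) (hd₂ : ty d₂ = 3) (hne : d₁ ≠ d₂)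
    (h₁ : IsConedSquare G d a d₁ a') (h₂ : IsConedSquare G d a d₂ a') :
    IsConedSquare G d₁ a d₂ a' := by
  obtain ⟨n, -, v, av, av', vd₁, vd⟩ := (h.isConedSquare_iff ha ha' hd₁ hd).1 h₁.rotate
  obtain ⟨-, -, w, aw, aw', wd₂, wd⟩ := (h.isConedSquare_iff ha ha' hd₂ hd).1 h₂.rotate
  refine ((h.isConedSquare_iff ha ha' hd₂ hd₁).2 ⟨n, hne.symm, ?_⟩).rotate.rotate.rotate
  by_cases hvw : v = w
  · exact ⟨v, av, av', hvw ▸ wd₂, vd₁⟩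
  obtain ⟨z, h1, h2, h3, h4⟩ := h.bowtie_d d hd a a' v w n hvw av aw av' aw' vd wd
  refine ⟨z, h1.lt_of_ne ?_, h2.lt_of_ne ?_, h.lt_of_le_of_lt h4 wd₂, h.lt_of_le_of_lt h3 vd₁⟩
  · rintro rfl
    exact n (h2.eq_of_type_le (by rw [ha, ha'])).symm
  · rintro rfl
    exact n (h1.eq_of_type_le (by rw [ha, ha']))

theorem not_isConedSquare (h : Is353Graph G ty)
    (k : IsUnfilledCorner G ty a x₁ x₂ x₃ y₁ y₂ y₃) {d' : V} (hd' : ty d' = 3) :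
    ¬ IsConedSquare G d' y₃ x₁ y₂ := by
  intro hs
  obtain ⟨-, -, v, v₃, v₂, vx, -⟩ :=
    (h.isConedSquare_iff k.bot₃ k.bot₂ k.top₁ hd').1 hs.rotate
  exact h.not_bounded k v₂ v₃ vx

end Is353Graph

/-! ### Cycles of length eight and ten in links -/

namespace Is353Graph

variable {V : Type*} {G : SimpleGraph V} {ty : V → Fin 4}

local infix:50 " ≺ " => RankLt G ty
local infix:50 " ≼ " => RankLe G ty

/-- Vertices of different types differ and adjacency is comparability, so only pairs of equal type
need be separated and only upward chords excluded. -/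
theorem isInducedCycle_of (h : Is353Graph G ty) {n : ℕ} [NeZero n] {w : Fin n → V}
    (hinj : ∀ i j, ty (w i) = ty (w j) → i < j → w i ≠ w j)
    (hadj : ∀ i, G.Adj (w i) (w (i + 1)))
    (hind : ∀ i j, ty (w i) < ty (w j) → w i ≺ w j → j = i + 1 ∨ i = j + 1) :
    IsInducedCycle G w := by
  refine ⟨fun i j hij => ?_, hadj, fun i j hij => ?_⟩
  · rcases lt_trichotomy i j with hlt | rfl | hlt
    · exact absurd hij (hinj i j (congrArg ty hij) hlt)
    · rfl
    · exact absurd hij.symm (hinj j i (congrArg ty hij.symm) hlt)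
  · rcases h.lt_of_adj hij with k | k
    · exact hind i j k.2 k
    · exact (hind j i k.2 k).symm

/-- The 8-cycle condition with embeddedness and inducedness spelled out pair by pair. -/
theorem not_eight (h : Is353Graph G ty) {a₁ a₂ a₃ b c₁ c₂ c₃ c₄ d : V} (hd : ty d = 3)
    (ha₁ : ty a₁ = 0) (ha₂ : ty a₂ = 0) (ha₃ : ty a₃ = 0) (hb : ty b = 1) (hc₁ : ty c₁ = 2)
    (hc₂ : ty c₂ = 2) (hc₃ : ty c₃ = 2) (hc₄ : ty c₄ = 2)
    (d₁ : c₁ ≺ d) (d₂ : c₂ ≺ d) (d₃ : c₃ ≺ d) (d₄ : c₄ ≺ d)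
    (h₁₁ : a₁ ≺ c₁) (h₂₁ : a₂ ≺ c₁) (h₂₂ : a₂ ≺ c₂) (h₃₂ : a₃ ≺ c₂) (h₃₃ : a₃ ≺ c₃)
    (b₃ : b ≺ c₃) (b₄ : b ≺ c₄) (h₁₄ : a₁ ≺ c₄)
    (na₁₂ : a₁ ≠ a₂) (na₁₃ : a₁ ≠ a₃) (na₂₃ : a₂ ≠ a₃)
    (nc₁₂ : c₁ ≠ c₂) (nc₁₃ : c₁ ≠ c₃) (nc₁₄ : c₁ ≠ c₄) (nc₂₃ : c₂ ≠ c₃) (nc₂₄ : c₂ ≠ c₄)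
    (nc₃₄ : c₃ ≠ c₄) (n₁₂ : ¬ a₁ ≺ c₂) (n₁₃ : ¬ a₁ ≺ c₃) (n₂₃ : ¬ a₂ ≺ c₃) (n₂₄ : ¬ a₂ ≺ c₄)
    (n₃₁ : ¬ a₃ ≺ c₁) (n₃₄ : ¬ a₃ ≺ c₄) (nb₁ : ¬ b ≺ c₁) (nb₂ : ¬ b ≺ c₂)
    (m₁ : ¬ a₁ ≺ b) (m₂ : ¬ a₂ ≺ b) (m₃ : ¬ a₃ ≺ b) : False := by
  have ht : ∀ i, ty (![a₁, c₁, a₂, c₂, a₃, c₃, b, c₄] i) = ![0, 2, 0, 2, 0, 2, 1, 2] i := by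
    intro i
    fin_cases i <;> assumption
  refine h.eight_d d hd ![a₁, c₁, a₂, c₂, a₃, c₃, b, c₄] ?_ ht (h.isInducedCycle_of ?_ ?_ ?_)
  · have e₁ := h.trans _ _ _ h₁₁ d₁
    have e₂ := h.trans _ _ _ h₂₂ d₂
    have e₃ := h.trans _ _ _ h₃₂ d₂
    have e₄ := h.trans _ _ _ b₃ d₃
    intro i
    fin_cases i
    exacts [e₁.1, d₁.1, e₂.1, d₂.1, e₃.1, d₃.1, e₄.1, d₄.1]
  · intro i j hij hlt
    rw [ht, ht] at hij
    fin_cases i <;> fin_cases j <;> first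
      | exact absurd hij (by decide) | exact absurd hlt (by decide) | assumption
  · intro i
    fin_cases i
    exacts [h₁₁.1, h₂₁.1.symm, h₂₂.1, h₃₂.1.symm, h₃₃.1, b₃.1.symm, b₄.1, h₁₄.1.symm]
  · intro i j hlt hij
    rw [ht, ht] at hlt
    fin_cases i <;> fin_cases j <;> first
      | exact absurd hlt (by decide) | exact .inl rfl | exact .inr rfl
      | exact absurd hij (by assumption)

theorem exists_of_ten (h : Is353Graph G ty) {a₂ a₅ b₁ b₃ b₄ c₁ c₂ c₃ c₄ c₅ d : V}
    (hd : ty d = 3) (ha₂ : ty a₂ = 0) (ha₅ : ty a₅ = 0) (hb₁ : ty b₁ = 1) (hb₃ : ty b₃ = 1)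
    (hb₄ : ty b₄ = 1) (hc₁ : ty c₁ = 2) (hc₂ : ty c₂ = 2) (hc₃ : ty c₃ = 2) (hc₄ : ty c₄ = 2)
    (hc₅ : ty c₅ = 2) (d₁ : c₁ ≺ d) (d₂ : c₂ ≺ d) (d₃ : c₃ ≺ d) (d₄ : c₄ ≺ d) (d₅ : c₅ ≺ d)
    (h₁₁ : b₁ ≺ c₁) (h₁₂ : b₁ ≺ c₂) (h₂₂ : a₂ ≺ c₂) (h₂₃ : a₂ ≺ c₃) (h₃₃ : b₃ ≺ c₃)
    (h₃₄ : b₃ ≺ c₄) (h₄₄ : b₄ ≺ c₄) (h₄₅ : b₄ ≺ c₅) (h₅₅ : a₅ ≺ c₅) (h₅₁ : a₅ ≺ c₁)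
    (na : a₂ ≠ a₅) (nb₁₃ : b₁ ≠ b₃) (nb₁₄ : b₁ ≠ b₄) (nb₃₄ : b₃ ≠ b₄)
    (nc₁₂ : c₁ ≠ c₂) (nc₁₃ : c₁ ≠ c₃) (nc₁₄ : c₁ ≠ c₄) (nc₁₅ : c₁ ≠ c₅) (nc₂₃ : c₂ ≠ c₃)
    (nc₂₄ : c₂ ≠ c₄) (nc₂₅ : c₂ ≠ c₅) (nc₃₄ : c₃ ≠ c₄) (nc₃₅ : c₃ ≠ c₅) (nc₄₅ : c₄ ≠ c₅)
    (n₁₃ : ¬ b₁ ≺ c₃) (n₁₄ : ¬ b₁ ≺ c₄) (n₁₅ : ¬ b₁ ≺ c₅)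
    (n₃₁ : ¬ b₃ ≺ c₁) (n₃₂ : ¬ b₃ ≺ c₂) (n₃₅ : ¬ b₃ ≺ c₅)
    (n₄₁ : ¬ b₄ ≺ c₁) (n₄₂ : ¬ b₄ ≺ c₂) (n₄₃ : ¬ b₄ ≺ c₃)
    (n₂₁ : ¬ a₂ ≺ c₁) (n₂₄ : ¬ a₂ ≺ c₄) (n₂₅ : ¬ a₂ ≺ c₅)
    (n₅₂ : ¬ a₅ ≺ c₂) (n₅₃ : ¬ a₅ ≺ c₃) (n₅₄ : ¬ a₅ ≺ c₄)
    (m₂₁ : ¬ a₂ ≺ b₁) (m₂₃ : ¬ a₂ ≺ b₃) (m₂₄ : ¬ a₂ ≺ b₄)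
    (m₅₁ : ¬ a₅ ≺ b₁) (m₅₃ : ¬ a₅ ≺ b₃) (m₅₄ : ¬ a₅ ≺ b₄) :
    ∃ a, ty a = 0 ∧ a ≺ b₁ ∧ a ≺ b₃ ∧ a ≺ b₄ := by
  have ht : ∀ i, ty (![c₁, b₁, c₂, a₂, c₃, b₃, c₄, b₄, c₅, a₅] i) =
      ![2, 1, 2, 0, 2, 1, 2, 1, 2, 0] i := by
    intro i
    fin_cases i <;> assumption
  have hadj : ∀ i, G.Adj (![c₁, b₁, c₂, a₂, c₃, b₃, c₄, b₄, c₅, a₅] i) d := by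
    have e₁ := h.trans _ _ _ h₁₁ d₁
    have e₂ := h.trans _ _ _ h₂₂ d₂
    have e₃ := h.trans _ _ _ h₃₃ d₃
    have e₄ := h.trans _ _ _ h₄₄ d₄
    have e₅ := h.trans _ _ _ h₅₅ d₅
    intro i
    fin_cases i
    exacts [d₁.1, e₁.1, d₂.1, e₂.1, d₃.1, e₃.1, d₄.1, e₄.1, d₅.1, e₅.1]
  have hcyc : IsInducedCycle G ![c₁, b₁, c₂, a₂, c₃, b₃, c₄, b₄, c₅, a₅] := by
    refine h.isInducedCycle_of ?_ ?_ ?_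
    · intro i j hij hlt
      rw [ht, ht] at hij
      fin_cases i <;> fin_cases j <;> first
        | exact absurd hij (by decide) | exact absurd hlt (by decide) | assumption
    · intro i
      fin_cases i
      exacts [h₁₁.1.symm, h₁₂.1, h₂₂.1.symm, h₂₃.1, h₃₃.1.symm, h₃₄.1, h₄₄.1.symm, h₄₅.1,
        h₅₅.1.symm, h₅₁.1]
    · intro i j hlt hij
      rw [ht, ht] at hlt
      fin_cases i <;> fin_cases j <;> first
        | exact absurd hlt (by decide) | exact .inl rfl | exact .inr rfl
        | exact absurd hij (by assumption)
  obtain ⟨a, -, ha, hab⟩ := h.ten_d d hd _ hadj ht hcyc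
  -- The type 1 vertices `b₁, b₃, b₄` occupy positions 1, 5, 7 of the cycle.
  exact ⟨a, ha, h.lt_of_adj_bot ha (hab 1 (ht 1)), h.lt_of_adj_bot ha (hab 5 (ht 5)),
    h.lt_of_adj_bot ha (hab 7 (ht 7))⟩

variable {a x₁ x₂ x₃ y₁ y₂ y₃ : V}

/-- If `a'` has common upper bounds with `y₂` and with `y₃` in the link of `x₁`, then it is a
lower bound of `x₂` and `x₃`, through a common lower bound of `x₁, x₂, x₃`. -/
theorem exists_lt_of_bounded (h : Is353Graph G ty)
    (k : IsUnfilledCorner G ty a x₁ x₂ x₃ y₁ y₂ y₃) {a' v₂ v₃ : V} (ha' : ty a' = 0)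
    (n₂ : a' ≠ y₂) (n₃ : a' ≠ y₃) (av₂ : a' ≺ v₂) (yv₂ : y₂ ≺ v₂) (vx₂ : v₂ ≺ x₁)
    (av₃ : a' ≺ v₃) (yv₃ : y₃ ≺ v₃) (vx₃ : v₃ ≺ x₁) :
    ∃ b, a ≺ b ∧ a' ≺ b ∧ b ≺ x₁ ∧ b ≺ x₂ ∧ b ≺ x₃ := by
  obtain ⟨b, c₁, c₂, c₃, q⟩ := h.exists_cornerCone k
  refine ⟨b, q.center_lt, ?_, h.trans _ _ _ q.lt₂ q.lt₂₁, h.trans _ _ _ q.lt₁ q.lt₁₂,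
    h.trans _ _ _ q.lt₁ q.lt₁₃⟩
  by_contra hn
  obtain ⟨u₂, tu₂, vu₂, ux₂⟩ := h.exists_type_two k.top₁ vx₂ (ha' ▸ av₂.2)
  obtain ⟨u₃, tu₃, vu₃, ux₃⟩ := h.exists_type_two k.top₁ vx₃ (ha' ▸ av₃.2)
  replace av₂ := h.lt_of_lt_of_le av₂ vu₂
  replace yv₂ := h.lt_of_lt_of_le yv₂ vu₂
  replace av₃ := h.lt_of_lt_of_le av₃ vu₃
  replace yv₃ := h.lt_of_lt_of_le yv₃ vu₃
  have nb : ∀ {v}, y₂ ≺ v → y₃ ≺ v → ¬ v ≺ x₁ := fun r s t => h.not_bounded k r s t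
  have below : ∀ {x}, ty x = 0 → x ≺ c₂ → x ≺ c₃ → x ≺ b := fun hx r s =>
    h.lt_of_lt_two k.top₁ q.type_b hx q.type₂ q.type₃ q.ne₂₃ q.lt₂ q.lt₃ r s q.lt₂₁ q.lt₃₁
  have n₃₂ : ¬ y₃ ≺ c₂ := fun r => q.not_lt₃ (below k.bot₃ r q.bot_lt₃)
  have n₂₃ : ¬ y₂ ≺ c₃ := fun r => q.not_lt₂ (below k.bot₂ q.bot_lt₂ r)
  -- If `a' ≺ c₂`, then `a'` and `y₃`, which have the common upper bound `u₃`, would force `a' ≺ b`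
  -- or `y₃ ≺ b`.
  have e₂ : ¬ a' ≺ c₂ := fun r =>
    (h.lt_or_lt_of_bounded k.center q.type_b q.type₂ q.type₃ k.top₁ ha' k.bot₃ q.center_lt
      q.lt₂ q.lt₃ q.lt₂₁ q.lt₃₁ q.ne₂₃ r q.bot_lt₃ av₃ yv₃ ux₃).elim hn q.not_lt₃
  have e₃ : ¬ a' ≺ c₃ := fun r =>
    (h.lt_or_lt_of_bounded k.center q.type_b q.type₂ q.type₃ k.top₁ k.bot₂ ha' q.center_lt
      q.lt₂ q.lt₃ q.lt₂₁ q.lt₃₁ q.ne₂₃ q.bot_lt₂ r yv₂ av₂ ux₂).elim q.not_lt₂ hn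
  have nu₂ : u₂ ≠ c₂ := fun e => e₂ (e ▸ av₂)
  have nu₃ : u₃ ≠ c₃ := fun e => e₃ (e ▸ av₃)
  -- The forbidden cycle in the link of `x₁` is `y₃ u₃ a' u₂ y₂ c₂ b c₃`. Every coincidence or chord
  -- would bound `y₂` and `y₃` together, or put one of `y₂, y₃, a'` below `b`, or is excluded by
  -- `e₂`, `e₃`.
  exact h.not_eight k.top₁ k.bot₃ ha' k.bot₂ q.type_b tu₃ tu₂ q.type₂ q.type₃ ux₃ ux₂ q.lt₂₁
    q.lt₃₁ yv₃ av₃ av₂ yv₂ q.bot_lt₂ q.lt₂ q.lt₃ q.bot_lt₃ n₃.symm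
    (fun e => nb (e ▸ yv₃) yv₃ ux₃) n₂
    (fun e => nb yv₂ (e ▸ yv₃) ux₂) (fun e => e₂ (e ▸ av₃)) nu₃ nu₂ (fun e => e₃ (e ▸ av₂))
    q.ne₂₃ (fun r => nb yv₂ r ux₂) n₃₂ e₂ e₃ (fun r => nb r yv₃ ux₃) n₂₃
    (fun r => q.not_lt₃ (h.lt_of_lt_two k.top₁ q.type_b k.bot₃ tu₃ q.type₃ nu₃ r q.lt₃ yv₃
      q.bot_lt₃ ux₃ q.lt₃₁))
    (fun r => q.not_lt₂ (h.lt_of_lt_two k.top₁ q.type_b k.bot₂ tu₂ q.type₂ nu₂ r q.lt₂ yv₂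
      q.bot_lt₂ ux₂ q.lt₂₁))
    q.not_lt₃ hn q.not_lt₂

end Is353Graph

/-! ### Replacing three corners around a vertex -/

namespace Is353Graph

variable {V : Type*} {G : SimpleGraph V} {ty : V → Fin 4}

local infix:50 " ≺ " => RankLt G ty
local infix:50 " ≼ " => RankLe G ty

/-- Here `cᵢ` is the cone point of the square around `d` containing `dᵢ`, while `bᵢ` and `gᵢ` are
the lower vertex of the corner at `eᵢ` and the cone point of its outer square. The 10-cycle is `c₁
b₁ c₂ a₂ c₃ b₃ c₄ b₄ c₅ a₅`. Most chords contradict `not_bounded` or the meet property; the possible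
coincidences `c₂ = c₃` and `c₁ = c₅` need the 8-cycle condition. The vertex below `b₁, b₃, b₄` is
then below every `cᵢ` and `gᵢ`. -/
theorem exists_replacement (h : Is353Graph G ty)
    {d d₁ d₂ d₃ d₄ d₅ a₁ a₂ a₃ a₄ a₅ e₁ e₃ e₄ : V}
    (k₁ : IsUnfilledCorner G ty e₁ d d₁ d₂ a₁ a₂ a₅)
    (k₃ : IsUnfilledCorner G ty e₃ d d₃ d₄ a₃ e₄ a₂)
    (k₄ : IsUnfilledCorner G ty e₄ d d₄ d₅ a₄ a₅ e₃) :
    ∃ a', ty a' = 0 ∧ G.Adj a' d ∧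
      IsConedSquare G a' d₁ a₁ d₂ ∧ IsConedSquare G a' d₂ a₂ d₃ ∧ IsConedSquare G a' d₃ a₃ d₄ ∧
      IsConedSquare G a' d₄ a₄ d₅ ∧ IsConedSquare G a' d₅ a₅ d₁ := by
  have hd := k₁.top₁
  have ha₂ := k₁.bot₂
  have ha₅ := k₁.bot₃
  have he₃ := k₃.center
  have he₄ := k₄.center
  obtain ⟨b₁, g₁, c₂, c₁, q₁⟩ := h.exists_cornerCone k₁
  obtain ⟨b₃, g₃, c₄, c₃, q₃⟩ := h.exists_cornerCone k₃
  obtain ⟨b₄, g₄, c₅, c, q₄⟩ := h.exists_cornerCone k₄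
  -- The corners at `e₃` and `e₄` share the square `d e₃ d₄ e₄`, whose type 2 cone point is unique.
  obtain rfl : c₄ = c := h.eq_of_type_two he₃ q₃.type₂ q₄.type₃ hd k₃.top₃
    (h.trans _ _ _ q₃.center_lt q₃.lt₂) q₄.bot_lt₃ q₃.lt₂₁ q₃.lt₂₃ q₄.lt₃₁ q₄.lt₃₂
    k₃.sq₂.1.2.2.2.2.2.symm
  -- pairs without a common upper bound
  have N₁ : ∀ {v}, a₂ ≺ v → a₅ ≺ v → ¬ v ≺ d := fun r s t => h.not_bounded k₁ r s t
  have N₃ : ∀ {v}, e₄ ≺ v → a₂ ≺ v → ¬ v ≺ d := fun r s t => h.not_bounded k₃ r s t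
  have N₄ : ∀ {v}, a₅ ≺ v → e₃ ≺ v → ¬ v ≺ d := fun r s t => h.not_bounded k₄ r s t
  have a₂c₂ := q₁.bot_lt₂
  have a₂c₃ := q₃.bot_lt₃
  have a₅c₁ := q₁.bot_lt₃
  have a₅c₅ := q₄.bot_lt₂
  have e₃c₃ := h.trans _ _ _ q₃.center_lt q₃.lt₃
  have e₃c₄ := h.trans _ _ _ q₃.center_lt q₃.lt₂
  have e₄c₄ := h.trans _ _ _ q₄.center_lt q₄.lt₃
  have e₄c₅ := h.trans _ _ _ q₄.center_lt q₄.lt₂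
  have a₂c₄ : ¬ a₂ ≺ c₄ := fun r => q₃.not_lt₃ <| h.lt_of_lt_two hd q₃.type_b ha₂ q₃.type₂
    q₃.type₃ q₃.ne₂₃ q₃.lt₂ q₃.lt₃ r a₂c₃ q₃.lt₂₁ q₃.lt₃₁
  have a₅c₄ : ¬ a₅ ≺ c₄ := fun r => q₄.not_lt₂ <| h.lt_of_lt_two hd q₄.type_b ha₅ q₄.type₂
    q₄.type₃ q₄.ne₂₃ q₄.lt₂ q₄.lt₃ a₅c₅ r q₄.lt₂₁ q₄.lt₃₁
  have c₂c₄ : c₂ ≠ c₄ := fun e => a₂c₄ (e ▸ a₂c₂)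
  have c₁c₄ : c₁ ≠ c₄ := fun e => a₅c₄ (e ▸ a₅c₁)
  have c₂c₅ : c₂ ≠ c₅ := fun e => N₁ a₂c₂ (e ▸ a₅c₅) q₁.lt₂₁
  have c₁c₃ : c₁ ≠ c₃ := fun e => N₁ (e ▸ a₂c₃) a₅c₁ q₁.lt₃₁
  have c₃c₅ : c₃ ≠ c₅ := fun e => N₁ a₂c₃ (e ▸ a₅c₅) q₃.lt₃₁
  have b₁c₄ : ¬ b₁ ≺ c₄ := fun r =>
    (h.lt_or_lt_of_bounded k₁.center q₁.type_b q₁.type₂ q₃.type₂ hd ha₂ he₃ q₁.center_lt q₁.lt₂ r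
      q₁.lt₂₁ q₃.lt₂₁ c₂c₄ a₂c₂ e₃c₄ a₂c₃ e₃c₃ q₃.lt₃₁).elim q₁.not_lt₂
      fun s => N₄ a₅c₁ (h.trans _ _ _ s q₁.lt₃) q₁.lt₃₁
  -- Since `e₃` and `e₄` are both below `c₄`, having both relations would put one of them below
  -- `b₁`, hence below both `c₁` and `c₂`, and so bounded together with `a₅` or `a₂`.
  have cross : e₃ ≺ c₂ → ¬ e₄ ≺ c₁ := fun r s =>
    (h.lt_or_lt_of_bounded k₁.center q₁.type_b q₁.type₂ q₁.type₃ hd he₃ he₄ q₁.center_lt q₁.lt₂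
      q₁.lt₃ q₁.lt₂₁ q₁.lt₃₁ q₁.ne₂₃ r s e₃c₄ e₄c₄ q₃.lt₂₁).elim
      (fun t => N₄ a₅c₁ (h.trans _ _ _ t q₁.lt₃) q₁.lt₃₁)
      fun t => N₃ (h.trans _ _ _ t q₁.lt₂) a₂c₂ q₁.lt₂₁
  have e₃a₅ : e₃ ≠ a₅ := fun e => a₅c₄ (e ▸ e₃c₄)
  have e₄a₂ : e₄ ≠ a₂ := fun e => a₂c₄ (e ▸ e₄c₄)
  have e₄a₅ : e₄ ≠ a₅ := fun e => a₅c₄ (e ▸ e₄c₄)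
  have e₃a₂ : e₃ ≠ a₂ := fun e => a₂c₄ (e ▸ e₃c₄)
  have e₃e₄ : e₃ ≠ e₄ := fun e => N₄ a₅c₅ (e ▸ e₄c₅) q₄.lt₂₁
  have e₄c₂ : ¬ e₄ ≺ c₂ := fun r => N₃ r a₂c₂ q₁.lt₂₁
  have e₃c₁ : ¬ e₃ ≺ c₁ := fun r => N₄ a₅c₁ r q₁.lt₃₁
  have a₅c₂ : ¬ a₅ ≺ c₂ := fun r => N₁ a₂c₂ r q₁.lt₂₁
  have a₂c₁ : ¬ a₂ ≺ c₁ := fun r => N₁ r a₅c₁ q₁.lt₃₁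
  have b₁c₅ : c₁ ≠ c₅ → ¬ b₁ ≺ c₅ := fun n r => q₁.not_lt₃ <|
    h.lt_of_lt_two hd q₁.type_b ha₅ q₁.type₃ q₄.type₂ n q₁.lt₃ r a₅c₁ a₅c₅ q₁.lt₃₁ q₄.lt₂₁
  have b₁c₃ : c₂ ≠ c₃ → ¬ b₁ ≺ c₃ := fun n r => q₁.not_lt₂ <|
    h.lt_of_lt_two hd q₁.type_b ha₂ q₁.type₂ q₃.type₃ n q₁.lt₂ r a₂c₂ a₂c₃ q₁.lt₂₁ q₃.lt₃₁
  have c₂c₃ : c₂ ≠ c₃ := by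
    intro e
    have e₃c₂ : e₃ ≺ c₂ := e ▸ e₃c₃
    have e₄c₁ := cross e₃c₂
    have c₁c₅ : c₁ ≠ c₅ := fun e' => e₄c₁ (e' ▸ e₄c₅)
    -- If `c₂ = c₃`, the cycle `e₃ c₄ e₄ c₅ a₅ c₁ b₁ c₂` closes up.
    exact h.not_eight hd he₃ he₄ ha₅ q₁.type_b q₃.type₂ q₄.type₂ q₁.type₃ q₁.type₂ q₃.lt₂₁ q₄.lt₂₁
      q₁.lt₃₁ q₁.lt₂₁ e₃c₄ e₄c₄ e₄c₅ a₅c₅ a₅c₁ q₁.lt₃ q₁.lt₂ e₃c₂ e₃e₄ e₃a₅ e₄a₅ q₄.ne₂₃.symm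
      c₁c₄.symm c₂c₄.symm c₁c₅.symm c₂c₅.symm q₁.ne₂₃.symm (fun r => N₄ a₅c₅ r q₄.lt₂₁) e₃c₁ e₄c₁
      e₄c₂ a₅c₄ a₅c₂ b₁c₄ (b₁c₅ c₁c₅) (fun r => e₃c₁ (h.trans _ _ _ r q₁.lt₃))
      (fun r => e₄c₂ (h.trans _ _ _ r q₁.lt₂)) q₁.not_lt₃
  have c₁c₅ : c₁ ≠ c₅ := by
    intro e
    have e₄c₁ : e₄ ≺ c₁ := e ▸ e₄c₅
    have e₃c₂ : ¬ e₃ ≺ c₂ := fun r => cross r e₄c₁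
    -- If `c₁ = c₅`, the cycle `e₄ c₄ e₃ c₃ a₂ c₂ b₁ c₁` closes up.
    exact h.not_eight hd he₄ he₃ ha₂ q₁.type_b q₃.type₂ q₃.type₃ q₁.type₂ q₁.type₃ q₃.lt₂₁ q₃.lt₃₁
      q₁.lt₂₁ q₁.lt₃₁ e₄c₄ e₃c₄ e₃c₃ a₂c₃ a₂c₂ q₁.lt₂ q₁.lt₃ e₄c₁ e₃e₄.symm e₄a₂ e₃a₂ q₃.ne₂₃
      c₂c₄.symm c₁c₄.symm c₂c₃.symm c₁c₃.symm q₁.ne₂₃ (fun r => N₃ r a₂c₃ q₃.lt₃₁) e₄c₂ e₃c₂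
      e₃c₁ a₂c₄ a₂c₁ b₁c₄ (b₁c₃ c₂c₃) (fun r => e₄c₂ (h.trans _ _ _ r q₁.lt₂))
      (fun r => e₃c₁ (h.trans _ _ _ r q₁.lt₃)) q₁.not_lt₂
  have b₃c₂ : ¬ b₃ ≺ c₂ := fun r => q₃.not_lt₃ <|
    h.lt_of_lt_two hd q₃.type_b ha₂ q₁.type₂ q₃.type₃ c₂c₃ r q₃.lt₃ a₂c₂ a₂c₃ q₁.lt₂₁ q₃.lt₃₁
  have b₄c₁ : ¬ b₄ ≺ c₁ := fun r => q₄.not_lt₂ <|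
    h.lt_of_lt_two hd q₄.type_b ha₅ q₁.type₃ q₄.type₂ c₁c₅ r q₄.lt₂ a₅c₁ a₅c₅ q₁.lt₃₁ q₄.lt₂₁
  obtain ⟨a, ha, ab₁, ab₃, ab₄⟩ := h.exists_of_ten hd ha₂ ha₅ q₁.type_b q₃.type_b q₄.type_b
    q₁.type₃ q₁.type₂ q₃.type₃ q₃.type₂ q₄.type₂ q₁.lt₃₁ q₁.lt₂₁ q₃.lt₃₁ q₃.lt₂₁ q₄.lt₂₁
    q₁.lt₃ q₁.lt₂ a₂c₂ a₂c₃ q₃.lt₃ q₃.lt₂ q₄.lt₃ q₄.lt₂ a₅c₅ a₅c₁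
    (fun e => a₅c₂ (e ▸ a₂c₂)) (fun e => b₁c₄ (e ▸ q₃.lt₂)) (fun e => b₁c₄ (e ▸ q₄.lt₃))
    (fun e => q₃.not_lt₂ (e ▸ q₄.center_lt)) q₁.ne₂₃.symm c₁c₃ c₁c₄ c₁c₅ c₂c₃ c₂c₄ c₂c₅
    q₃.ne₂₃.symm c₃c₅ q₄.ne₂₃.symm (b₁c₃ c₂c₃) b₁c₄ (b₁c₅ c₁c₅)
    (fun r => e₃c₁ (h.trans _ _ _ q₃.center_lt r)) b₃c₂
    (fun r => N₄ a₅c₅ (h.trans _ _ _ q₃.center_lt r) q₄.lt₂₁) b₄c₁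
    (fun r => e₄c₂ (h.trans _ _ _ q₄.center_lt r))
    (fun r => N₃ (h.trans _ _ _ q₄.center_lt r) a₂c₃ q₃.lt₃₁)
    a₂c₁ a₂c₄ (fun r => N₁ r a₅c₅ q₄.lt₂₁) a₅c₂ (fun r => N₁ a₂c₃ r q₃.lt₃₁) a₅c₄
    q₁.not_lt₂ q₃.not_lt₃ (fun r => a₂c₄ (h.trans _ _ _ r q₄.lt₃))
    q₁.not_lt₃ (fun r => a₅c₄ (h.trans _ _ _ r q₃.lt₂)) q₄.not_lt₂
  have ac₁ := h.trans _ _ _ ab₁ q₁.lt₃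
  have ac₂ := h.trans _ _ _ ab₁ q₁.lt₂
  have ac₃ := h.trans _ _ _ ab₃ q₃.lt₃
  have ac₅ := h.trans _ _ _ ab₄ q₄.lt₂
  have aa₂ : a ≠ a₂ := fun e => q₁.not_lt₂ (e ▸ ab₁)
  have aa₅ : a ≠ a₅ := fun e => q₁.not_lt₃ (e ▸ ab₁)
  refine ⟨a, ha, (h.trans _ _ _ ac₁ q₁.lt₃₁).1, ?_, ?_, ?_, ?_, ?_⟩
  · exact (h.isConedSquare_iff ha k₁.bot₁ k₁.top₂ k₁.top₃).2 ⟨fun e => q₁.not_lt₁ (e ▸ ab₁),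
      k₁.sq₁.1.2.2.2.2.2, g₁, h.trans _ _ _ ab₁ q₁.lt₁, q₁.bot_lt₁, q₁.lt₁₂, q₁.lt₁₃⟩
  -- The squares at `a₂` and `a₅` have no ready cone point; the meet of the two adjacent `cᵢ`
  -- serves. Its construction and `d₂ ≠ d₃` both rest on `c₂ ≠ c₃`.
  · obtain ⟨b, -, ab, a₂b, bc₂, bc₃⟩ := h.exists_type_one hd ha ha₂ q₁.type₂ q₃.type₃ aa₂ c₂c₃ ac₂
      ac₃ a₂c₂ a₂c₃ q₁.lt₂₁ q₃.lt₃₁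
    refine (h.isConedSquare_iff ha ha₂ k₁.top₃ k₃.top₂).2 ⟨aa₂, fun e => c₂c₃ ?_, b, ab, a₂b,
      h.trans _ _ _ bc₂ q₁.lt₂₃, h.trans _ _ _ bc₃ q₃.lt₃₂⟩
    exact h.eq_of_type_two ha₂ q₁.type₂ q₃.type₃ hd k₁.top₃ a₂c₂ a₂c₃ q₁.lt₂₁ q₁.lt₂₃ q₃.lt₃₁
      (e ▸ q₃.lt₃₂) k₁.sq₂.1.2.2.2.2.2.symm
  · exact (h.isConedSquare_iff ha k₃.bot₁ k₃.top₂ k₃.top₃).2 ⟨fun e => q₃.not_lt₁ (e ▸ ab₃),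
      k₃.sq₁.1.2.2.2.2.2, g₃, h.trans _ _ _ ab₃ q₃.lt₁, q₃.bot_lt₁, q₃.lt₁₂, q₃.lt₁₃⟩
  · exact (h.isConedSquare_iff ha k₄.bot₁ k₄.top₂ k₄.top₃).2 ⟨fun e => q₄.not_lt₁ (e ▸ ab₄),
      k₄.sq₁.1.2.2.2.2.2, g₄, h.trans _ _ _ ab₄ q₄.lt₁, q₄.bot_lt₁, q₄.lt₁₂, q₄.lt₁₃⟩
  · obtain ⟨b, -, ab, a₅b, bc₁, bc₅⟩ := h.exists_type_one hd ha ha₅ q₁.type₃ q₄.type₂ aa₅ c₁c₅ ac₁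
      ac₅ a₅c₁ a₅c₅ q₁.lt₃₁ q₄.lt₂₁
    refine (h.isConedSquare_iff ha ha₅ k₄.top₃ k₁.top₂).2 ⟨aa₅, fun e => c₁c₅ ?_, b, ab, a₅b,
      h.trans _ _ _ bc₅ q₄.lt₂₃, h.trans _ _ _ bc₁ q₁.lt₃₂⟩
    exact h.eq_of_type_two ha₅ q₁.type₃ q₄.type₂ hd k₁.top₂ a₅c₁ a₅c₅ q₁.lt₃₁ q₁.lt₃₂ q₄.lt₂₁
      (e ▸ q₄.lt₂₃) k₁.sq₃.1.2.2.2.2.2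

end Is353Graph

/-! ### The conditions on squares -/

namespace SquareComplex

/-- `X` is, through the map `f`, the square complex on the vertices of types `0` and `3` of a
graph with types. -/
structure IsModelOf {V W : Type*} (X : SquareComplex W) (G : SimpleGraph V) (ty : V → Fin 4)
    (f : W → V) : Prop where
  injective : Function.Injective f
  surjective : ∀ v, ty v = 0 → ∃ x, f x = v
  type_of_mem : ∀ x ∈ X.sideA, ty (f x) = 0
  type_of_notMem : ∀ x ∉ X.sideA, ty (f x) = 3
  adj_iff : ∀ x y, X.graph.Adj x y ↔ G.Adj (f x) (f y)
  isSquare_iff : ∀ x y z t, X.IsSquare x y z t ↔ IsConedSquare G (f x) (f y) (f z) (f t)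

namespace IsModelOf

variable {V W : Type*} {X : SquareComplex W} {G : SimpleGraph V} {ty : V → Fin 4} {f : W → V}

theorem type_of_adj_notMem (m : X.IsModelOf G ty f) {x y : W} (h : X.graph.Adj x y)
    (hx : x ∉ X.sideA) : ty (f y) = 0 :=
  m.type_of_mem y (by_contra fun hy => hx ((X.bipartite x y h).2 hy))

theorem type_of_adj_mem (m : X.IsModelOf G ty f) {x y : W} (h : X.graph.Adj x y)
    (hx : x ∈ X.sideA) : ty (f y) = 3 :=
  m.type_of_notMem y ((X.bipartite x y h).1 hx)

/-- Minimality excludes a cut along each of the three diagonals, by rotating the corner. -/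
theorem isUnfilledCorner (m : X.IsModelOf G ty f) {o x₁ x₂ x₃ y₁ y₂ y₃ : W}
    (k : X.IsMinimalCubeCorner o x₁ x₂ x₃ y₁ y₂ y₃) (hx : x₁ ∉ X.sideA) :
    IsUnfilledCorner G ty (f o) (f x₁) (f x₂) (f x₃) (f y₁) (f y₂) (f y₃) := by
  obtain ⟨s₁, s₂, s₃⟩ := k.1
  have s₂' := X.rotate _ _ _ _ (X.rotate _ _ _ _ (X.rotate _ _ _ _ (X.reflect _ _ _ _ s₂)))
  have ho : o ∈ X.sideA := (X.bipartite o x₁ (X.adj_of_isSquare _ _ _ _ s₂)).2 hx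
  have hx₂ : x₂ ∉ X.sideA := (X.bipartite o x₂ (X.adj_of_isSquare _ _ _ _ s₁)).1 ho
  have hx₃ : x₃ ∉ X.sideA := (X.bipartite o x₃ (adj₄ s₁).symm).1 ho
  have n₁ := k.not_fill
  have n₂ := k.rotate.not_fill
  have n₃ := k.rotate.rotate.not_fill
  simp only [m.isSquare_iff, ← m.injective.eq_iff] at s₁ s₂' s₃ n₁ n₂ n₃
  exact ⟨m.type_of_mem o ho, m.type_of_notMem _ hx, m.type_of_notMem _ hx₂,
    m.type_of_notMem _ hx₃, m.type_of_adj_notMem (adj₂ k.1.1) hx₂,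
    m.type_of_adj_notMem (adj₂ k.1.2.1) hx, m.type_of_adj_notMem (adj₂ k.1.2.2) hx, s₁, s₂', s₃,
    n₁, n₂, n₃⟩

variable (m : X.IsModelOf G ty f) (h : Is353Graph G ty)
include m h

theorem axiom1 : X.Axiom1 := by
  intro d a d₁ d₂ a' hd hne h₁ h₂
  have had := X.adj_of_isSquare _ _ _ _ h₁
  have ha := m.type_of_adj_notMem had hd
  have ha' := m.type_of_adj_notMem (adj₄ h₁).symm hd
  have haA : a ∈ X.sideA := (X.bipartite a d had.symm).2 hd
  have hd₁ := m.type_of_adj_mem (adj₂ h₁) haA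
  have hd₂ := m.type_of_adj_mem (adj₂ h₂) haA
  rw [m.isSquare_iff] at *
  exact h.isConedSquare_trans ha ha' (m.type_of_notMem d hd) hd₁ hd₂ (m.injective.ne hne) h₁ h₂

theorem axiom2 : X.Axiom2 := by
  rintro a d d₁ d₂ a₁ a₂ a₃ hd k ⟨d', hs⟩
  have ha₁ : a₁ ∈ X.sideA := (X.bipartite a₁ d (adj₂ hs)).2 hd
  rw [m.isSquare_iff] at hs
  exact h.not_isConedSquare (m.isUnfilledCorner k hd)
    (m.type_of_adj_mem ((m.adj_iff _ _).2 hs.1.1.symm) ha₁) hs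

theorem axiom3 : X.Axiom3 := by
  rintro a d d₁ d₂ a₁ a₂ a₃ a' hd k hne ⟨d₄, h₄⟩ ⟨d₅, h₅⟩
  have hd3 := m.type_of_notMem d hd
  have ha' := m.type_of_adj_notMem (adj₂ h₄) hd
  have ha'A : a' ∈ X.sideA := (X.bipartite d a' (adj₂ h₄)).not_left.1 hd
  have hd₄ := m.type_of_adj_mem (adj₃ h₄) ha'A
  have hd₅ := m.type_of_adj_mem (adj₃ h₅) ha'A
  have q := m.isUnfilledCorner k hd
  rw [m.isSquare_iff] at h₄ h₅
  obtain ⟨n₁, -, v, v₁, av, vd, -⟩ := (h.isConedSquare_iff q.bot₃ ha' hd3 hd₄).1 h₄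
  obtain ⟨n₂, -, w, w₂, aw, wd, -⟩ := (h.isConedSquare_iff q.bot₂ ha' hd3 hd₅).1 h₅
  obtain ⟨b, ab, a'b, bd, bd₁, bd₂⟩ := h.exists_lt_of_bounded q ha' n₂.symm n₁.symm
    aw w₂ wd av v₁ vd
  have hn := m.injective.ne hne
  simp only [m.adj_iff, m.isSquare_iff]
  exact ⟨(h.trans _ _ _ a'b bd₁).1, (h.trans _ _ _ a'b bd₂).1,
    (h.isConedSquare_iff q.center ha' hd3 q.top₂).2
      ⟨hn.symm, q.sq₃.1.2.2.2.2.2, b, ab, a'b, bd, bd₁⟩,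
    (h.isConedSquare_iff q.center ha' hd3 q.top₃).2
      ⟨hn.symm, q.sq₂.1.2.2.2.2.2.symm, b, ab, a'b, bd, bd₂⟩⟩

theorem axiom4 : X.Axiom4 := by
  intro d d₁ d₂ d₃ d₄ d₅ a₁ a₂ a₃ a₄ a₅ e₁ e₃ e₄ hd _ _ _ _ _ _ _ _ k₁ k₃ k₄
  obtain ⟨a', ha', hs⟩ := h.exists_replacement (m.isUnfilledCorner k₁ hd)
    (m.isUnfilledCorner k₃ hd) (m.isUnfilledCorner k₄ hd)
  obtain ⟨x, rfl⟩ := m.surjective a' ha'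
  exact ⟨x, by simpa only [m.adj_iff, m.isSquare_iff] using hs⟩

end IsModelOf

end SquareComplex

theorem isModelOf_squareComplex {V : Type*} (Δ : TypedComplex (Fin 4) V) :
    (squareComplex Δ).IsModelOf Δ.graph Δ.type Subtype.val where
  injective := Subtype.val_injective
  surjective v hv := ⟨⟨v, .inl hv⟩, rfl⟩
  type_of_mem _ hx := hx
  type_of_notMem x hx := x.2.resolve_left hx
  adj_iff _ _ := .rfl
  isSquare_iff x y z t := by
    simp only [squareComplex, IsConedSquare, ne_eq, Subtype.ext_iff]

/-- Swapping the parts amounts to reversing the types, so the dual graph conditions yield the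
swapped axioms. -/
theorem isModelOf_swap_squareComplex {V : Type*} (Δ : TypedComplex (Fin 4) V) :
    (squareComplex Δ).swap.IsModelOf Δ.graph (fun v => (Δ.type v).rev) Subtype.val where
  injective := Subtype.val_injective
  surjective v hv := ⟨⟨v, .inr (by revert hv; generalize Δ.type v = i; revert i; decide)⟩, rfl⟩
  type_of_mem x hx := by
    have : Δ.type x = 3 := x.2.resolve_left hx
    simp [this]
  type_of_notMem x hx := by
    have : Δ.type x = 0 := not_not.1 hx
    simp [this]
  adj_iff _ _ := .rfl
  isSquare_iff := (isModelOf_squareComplex Δ).isSquare_iff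

end ThreeFiveThree

open CategoryTheory

namespace ThreeFiveThree

/-! ### The category of edge-paths up to homotopy -/

/-- The vertices of a complex as the objects of the category of homotopy classes of edge-paths. -/
structure EdgePathObj {V : Type*} (G : SimpleGraph V) (R : ∀ u : V, G.Walk u u → Prop) where
  /-- The vertex. -/
  pt : V

/-- Homotopy of edge-paths, as a setoid. -/
def edgeHomotopicSetoid {V : Type*} (G : SimpleGraph V) (R : ∀ u : V, G.Walk u u → Prop)
    (u v : V) : Setoid (G.Walk u v) where
  r := EdgeHomotopic G R
  iseqv := ⟨.refl, .symm, .trans⟩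

instance {V : Type*} (G : SimpleGraph V) (R : ∀ u : V, G.Walk u u → Prop) :
    Category (EdgePathObj G R) where
  Hom x y := Quotient (edgeHomotopicSetoid G R x.pt y.pt)
  id x := Quotient.mk _ .nil
  comp f g := Quotient.map₂ (fun p q => p.append q) (fun _ _ h _ _ h' => .append h h') f g
  id_comp f := by
    induction f using Quotient.ind
    rfl
  comp_id f := by
    induction f using Quotient.ind
    exact congrArg (Quotient.mk _) (SimpleGraph.Walk.append_nil _)
  assoc f g k := by
    induction f using Quotient.ind
    induction g using Quotient.ind
    induction k using Quotient.ind
    exact congrArg (Quotient.mk _) (SimpleGraph.Walk.append_assoc _ _ _).symm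

/-- The homotopy class of an edge-path. -/
def edgePathClass {V : Type*} {G : SimpleGraph V} (R : ∀ u : V, G.Walk u u → Prop) {u v : V}
    (p : G.Walk u v) : (⟨u⟩ : EdgePathObj G R) ⟶ ⟨v⟩ :=
  Quotient.mk (edgeHomotopicSetoid G R u v) p

section

variable {V : Type*} {G : SimpleGraph V} {R : ∀ u : V, G.Walk u u → Prop} {u v w : V}

theorem edgePathClass_nil : edgePathClass R (.nil : G.Walk u u) = 𝟙 _ := rfl

theorem edgePathClass_append (p : G.Walk u v) (q : G.Walk v w) :
    edgePathClass R (p.append q) = edgePathClass R p ≫ edgePathClass R q := rfl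

theorem edgePathClass_cons (h : G.Adj u v) (q : G.Walk v w) :
    edgePathClass R (.cons h q) = edgePathClass R (.cons h .nil) ≫ edgePathClass R q := rfl

theorem edgePathClass_eq_iff {p q : G.Walk u v} :
    edgePathClass R p = edgePathClass R q ↔ EdgeHomotopic G R p q :=
  Quotient.eq (r := edgeHomotopicSetoid G R u v)

end

/-! ### Bicliques: paths unique up to homotopy -/

namespace SquareComplex

variable {W : Type*} (X : SquareComplex W)

/-- A set of vertices inducing a complete bipartite graph all of whose `4`-cycles bound squares. -/
structure IsBiclique (S : Set W) : Prop where
  adj : ∀ x ∈ S, ∀ y ∈ S, x ∈ X.sideA → y ∉ X.sideA → X.graph.Adj x y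
  isSquare : ∀ x ∈ S, ∀ y ∈ S, ∀ z ∈ S, ∀ t ∈ S, X.graph.Adj x y → X.graph.Adj y z →
    X.graph.Adj z t → X.graph.Adj t x → x ≠ z → y ≠ t → X.IsSquare x y z t
  exists_mem : ∃ x ∈ S, x ∈ X.sideA
  exists_notMem : ∃ x ∈ S, x ∉ X.sideA

variable {X} {S T : Set W}

namespace IsBiclique

theorem adj' (hS : X.IsBiclique S) {x y : W} (hx : x ∈ S) (hy : y ∈ S)
    (h : x ∈ X.sideA ↔ y ∉ X.sideA) : X.graph.Adj x y := by
  by_cases hxA : x ∈ X.sideA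
  · exact hS.adj x hx y hy hxA (h.1 hxA)
  · exact (hS.adj y hy x hx (by tauto) hxA).symm

/-- Either the path backtracks, or closing it with the edge `x u` gives the boundary of a square. -/
theorem edgePathClass_three (hS : X.IsBiclique S) {u v w x : W} (hu : u ∈ S) (hv : v ∈ S)
    (hw : w ∈ S) (hx : x ∈ S) (h₁ : X.graph.Adj u v) (h₂ : X.graph.Adj v w)
    (h₃ : X.graph.Adj w x) (h : X.graph.Adj u x) :
    edgePathClass X.IsSquareWalk (.cons h₁ (.cons h₂ (.cons h₃ .nil))) =
      edgePathClass X.IsSquareWalk (.cons h .nil) := by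
  by_cases huw : u = w
  · subst huw
    have := edgePathClass_eq_iff.2 (EdgeHomotopic.backtrack (R := X.IsSquareWalk) h₁)
    exact congrArg (· ≫ edgePathClass X.IsSquareWalk (.cons h₃ .nil)) this
  by_cases hvx : v = x
  · subst hvx
    have := edgePathClass_eq_iff.2 (EdgeHomotopic.backtrack (R := X.IsSquareWalk) h₂)
    exact congrArg (edgePathClass X.IsSquareWalk (.cons h₁ .nil) ≫ ·) this
  have hsq := hS.isSquare u hu v hv w hw x hx h₁ h₂ h₃ h.symm huw hvx
  have e₁ := edgePathClass_eq_iff.2 (EdgeHomotopic.cell (R := X.IsSquareWalk)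
    (.cons h₁ (.cons h₂ (.cons h₃ (.cons h.symm .nil)))) ⟨rfl, hsq⟩)
  have e₂ := edgePathClass_eq_iff.2 (EdgeHomotopic.backtrack (R := X.IsSquareWalk) h.symm)
  calc edgePathClass X.IsSquareWalk (.cons h₁ (.cons h₂ (.cons h₃ .nil)))
      = edgePathClass X.IsSquareWalk (.cons h₁ (.cons h₂ (.cons h₃ .nil))) ≫
          edgePathClass X.IsSquareWalk (.cons h.symm (.cons h .nil)) := by
        rw [e₂, edgePathClass_nil, Category.comp_id]
    _ = edgePathClass X.IsSquareWalk (.cons h₁ (.cons h₂ (.cons h₃ (.cons h.symm .nil)))) ≫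
          edgePathClass X.IsSquareWalk (.cons h .nil) := rfl
    _ = edgePathClass X.IsSquareWalk (.cons h .nil) := by
        rw [e₁, edgePathClass_nil, Category.id_comp]

/-- Three initial edges can be replaced by one, which shortens the path by two; the shortest cases
are trivial or a backtrack. -/
theorem edgePathClass_closed (hS : X.IsBiclique S) {u : W} (p : X.graph.Walk u u)
    (hp : ∀ x ∈ p.support, x ∈ S) : edgePathClass X.IsSquareWalk p = 𝟙 _ := by
  induction hn : p.length using Nat.strong_induction_on generalizing u p with
  | _ n ih =>
    subst hn
    match p, hp, ih with
    | .nil, _, _ => rfl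
    | .cons h .nil, _, _ => exact (X.graph.irrefl h).elim
    | .cons h (.cons _ .nil), _, _ =>
      exact edgePathClass_eq_iff.2 (.backtrack h)
    | .cons (v := v) h₁ (.cons (v := w) h₂ (.cons (v := x) h₃ r)), hp, ih =>
      simp only [SimpleGraph.Walk.support_cons, List.mem_cons] at hp
      have hu : u ∈ S := hp u (by simp)
      have hx : x ∈ S := hp x (by simp)
      have hadj : X.graph.Adj u x := by
        refine hS.adj' hu hx ?_
        have b₁ := X.bipartite _ _ h₁
        have b₂ := X.bipartite _ _ h₂
        have b₃ := X.bipartite _ _ h₃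
        tauto
      have e := hS.edgePathClass_three hu (hp v (by simp)) (hp w (by simp)) hx h₁ h₂ h₃ hadj
      calc edgePathClass X.IsSquareWalk (.cons h₁ (.cons h₂ (.cons h₃ r)))
          = edgePathClass X.IsSquareWalk (.cons h₁ (.cons h₂ (.cons h₃ .nil))) ≫
              edgePathClass X.IsSquareWalk r := rfl
        _ = edgePathClass X.IsSquareWalk (.cons hadj r) := by rw [e]; rfl
        _ = 𝟙 _ := by
          refine ih _ ?_ _ ?_ rfl
          · simp
          · intro y hy
            simp only [SimpleGraph.Walk.support_cons, List.mem_cons] at hy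
            exact hp y (by tauto)

theorem edgePathClass_eq (hS : X.IsBiclique S) {u v : W} (p q : X.graph.Walk u v)
    (hp : ∀ x ∈ p.support, x ∈ S) (hq : ∀ x ∈ q.support, x ∈ S) :
    edgePathClass X.IsSquareWalk p = edgePathClass X.IsSquareWalk q := by
  have hq' : ∀ x ∈ q.reverse.support, x ∈ S := by simpa using hq
  have e₁ := hS.edgePathClass_closed (q.reverse.append q) fun x hx =>
    (SimpleGraph.Walk.mem_support_append_iff _ _ |>.1 hx).elim (hq' x) (hq x)
  have e₂ := hS.edgePathClass_closed (p.append q.reverse) fun x hx =>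
    (SimpleGraph.Walk.mem_support_append_iff _ _ |>.1 hx).elim (hp x) (hq' x)
  rw [edgePathClass_append] at e₁ e₂
  rw [← Category.comp_id (edgePathClass _ p), ← e₁, ← Category.assoc, e₂, Category.id_comp]

theorem exists_walk (hS : X.IsBiclique S) {x y : W} (hx : x ∈ S) (hy : y ∈ S) :
    ∃ p : X.graph.Walk x y, ∀ z ∈ p.support, z ∈ S := by
  by_cases h : x ∈ X.sideA ↔ y ∉ X.sideA
  · exact ⟨.cons (hS.adj' hx hy h) .nil, by simp [hx, hy]⟩
  · obtain ⟨t, ht, hxt, hty⟩ : ∃ t ∈ S, X.graph.Adj x t ∧ X.graph.Adj t y := by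
      by_cases hxA : x ∈ X.sideA
      · obtain ⟨t, ht, htA⟩ := hS.exists_notMem
        exact ⟨t, ht, hS.adj' hx ht (by tauto), hS.adj' ht hy (by tauto)⟩
      · obtain ⟨t, ht, htA⟩ := hS.exists_mem
        exact ⟨t, ht, hS.adj' hx ht (by tauto), hS.adj' ht hy (by tauto)⟩
    exact ⟨.cons hxt (.cons hty .nil), by simp [hx, hy, ht]⟩

/-- The unique homotopy class of edge-paths in `S` from `x` to `y`. -/
noncomputable def path (hS : X.IsBiclique S) {x y : W} (hx : x ∈ S) (hy : y ∈ S) :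
    (⟨x⟩ : EdgePathObj X.graph X.IsSquareWalk) ⟶ ⟨y⟩ :=
  edgePathClass X.IsSquareWalk (hS.exists_walk hx hy).choose

theorem path_eq (hS : X.IsBiclique S) {x y : W} (hx : x ∈ S) (hy : y ∈ S)
    (p : X.graph.Walk x y) (hp : ∀ z ∈ p.support, z ∈ S) :
    hS.path hx hy = edgePathClass X.IsSquareWalk p :=
  hS.edgePathClass_eq _ _ (hS.exists_walk hx hy).choose_spec hp

theorem path_self (hS : X.IsBiclique S) {x : W} (hx : x ∈ S) : hS.path hx hx = 𝟙 _ :=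
  hS.path_eq hx hx .nil (by simp [hx])

theorem path_edge (hS : X.IsBiclique S) {x y : W} (hx : x ∈ S) (hy : y ∈ S)
    (h : X.graph.Adj x y) : hS.path hx hy = edgePathClass X.IsSquareWalk (.cons h .nil) :=
  hS.path_eq hx hy _ (by simp [hx, hy])

theorem path_mono (hS : X.IsBiclique S) (hT : X.IsBiclique T) (hST : S ⊆ T) {x y : W}
    (hx : x ∈ S) (hy : y ∈ S) : hS.path hx hy = hT.path (hST hx) (hST hy) :=
  (hT.path_eq _ _ _ fun z hz => hST ((hS.exists_walk hx hy).choose_spec z hz)).symm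

theorem path_comp (hS : X.IsBiclique S) {x y z : W} (hx : x ∈ S) (hy : y ∈ S) (hz : z ∈ S) :
    hS.path hx hy ≫ hS.path hy hz = hS.path hx hz := by
  refine (hS.path_eq hx hz
    ((hS.exists_walk hx hy).choose.append (hS.exists_walk hy hz).choose) fun t ht => ?_).symm
  exact (SimpleGraph.Walk.mem_support_append_iff _ _ |>.1 ht).elim
    ((hS.exists_walk hx hy).choose_spec t) ((hS.exists_walk hy hz).choose_spec t)

theorem path_comp_assoc (hS : X.IsBiclique S) {x y z : W} (hx : x ∈ S) (hy : y ∈ S) (hz : z ∈ S)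
    {t : EdgePathObj X.graph X.IsSquareWalk} (f : (⟨z⟩ : EdgePathObj X.graph X.IsSquareWalk) ⟶ t) :
    hS.path hx hy ≫ hS.path hy hz ≫ f = hS.path hx hz ≫ f := by
  rw [← Category.assoc, path_comp]

end IsBiclique

end SquareComplex

end ThreeFiveThree

/-! ### Simple connectedness via stars of simplices -/

open CategoryTheory

namespace ThreeFiveThree

variable {V : Type*} {Δ : TypedComplex (Fin 4) V}

/-- The vertices of the square complex that span a simplex with each vertex of `s`. -/
def starSet (Δ : TypedComplex (Fin 4) V) (s : Finset V) :
    Set {v : V // Δ.type v = 0 ∨ Δ.type v = 3} :=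
  {x | ∀ v ∈ s, x.1 = v ∨ Δ.graph.Adj x.1 v}

theorem starSet_anti {s t : Finset V} (h : s ⊆ t) : starSet Δ t ⊆ starSet Δ s :=
  fun _ hx v hv => hx v (h hv)

theorem singleton_mem_faces (v : V) : {v} ∈ Δ.faces :=
  Δ.singleton_mem v

theorem mem_starSet_singleton {x : {v : V // Δ.type v = 0 ∨ Δ.type v = 3}} {v : V} :
    x ∈ starSet Δ {v} ↔ x.1 = v ∨ Δ.graph.Adj x.1 v := by
  simp [starSet]

theorem self_mem_starSet (x : {v : V // Δ.type v = 0 ∨ Δ.type v = 3}) :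
    x ∈ starSet Δ {x.1} := mem_starSet_singleton.2 (.inl rfl)

/-- An edge-path of the square complex as an edge-path of `Δ`. -/
def includeWalk : ∀ {x y : {v : V // Δ.type v = 0 ∨ Δ.type v = 3}},
    (squareComplex Δ).graph.Walk x y → Δ.graph.Walk x.1 y.1
  | _, _, .nil => .nil
  | _, _, .cons h p => .cons h (includeWalk p)

/-- For `v` in `s`, the vertices of types 0 and 3 in the star are comparable through `v`, and `v` is
a common neighbour of every embedded 4-cycle there. Completing `s` to a simplex with all types shows
that both sides occur. -/
theorem Is353Simplicial.isBiclique (hΔ : Is353Simplicial Δ) {s : Finset V} (hs : s ∈ Δ.faces) :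
    (squareComplex Δ).IsBiclique (starSet Δ s) := by
  have h := hΔ.is353Graph
  obtain ⟨v, hv⟩ := (Δ.isRelLowerSet_faces hs).1
  obtain ⟨t, ht, hst, hall⟩ := TypedComplex.exists_face_of_types hs
  have hmem : ∀ x (hx : Δ.type x = 0 ∨ Δ.type x = 3), x ∈ t →
      (⟨x, hx⟩ : {v : V // Δ.type v = 0 ∨ Δ.type v = 3}) ∈ starSet Δ s := by
    intro x hx hxt w hw
    by_cases hxw : x = w
    · exact .inl hxw
    · exact .inr (TypedComplex.adj_of_mem_face ht hxt (hst hw) hxw)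
  refine ⟨?_, ?_, ?_, ?_⟩
  · intro x hx y hy hxA hyA
    have tx : Δ.type x = 0 := hxA
    have ty : Δ.type y = 3 := y.2.resolve_left hyA
    change Δ.graph.Adj x.1 y.1
    rcases hx v hv with e | e
    · rcases hy v hv with e' | e'
      · rw [e.trans e'.symm, ty] at tx
        exact absurd tx (by decide)
      · rw [e]
        exact e'.symm
    · rcases hy v hv with e' | e'
      · rw [e']
        exact e
      · exact (h.trans _ _ _ (h.lt_of_adj_bot tx e) (h.lt_of_adj_top ty e'.symm)).1
  · intro x hx y hy z hz t ht h₁ h₂ h₃ h₄ hxz hyt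
    -- two vertices of the same type cannot both be in the star of one of them
    have same : ∀ {p q r : {v : V // Δ.type v = 0 ∨ Δ.type v = 3}}, p ∈ starSet Δ s →
        q ∈ starSet Δ s → (squareComplex Δ).graph.Adj p r → (squareComplex Δ).graph.Adj r q →
        p ≠ q → Δ.graph.Adj v p.1 := by
      intro p q r hp hq hpr hrq hne
      refine ((hp v hv).resolve_left fun e => ?_).symm
      have hqv := (hq v hv).resolve_left fun e' => hne (Subtype.ext (e.trans e'.symm))
      have k := Δ.type_ne _ _ hqv
      have k₁ := Δ.type_ne _ _ hpr
      have k₂ := Δ.type_ne _ _ hrq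
      have k₃ := p.2
      have k₄ := q.2
      have k₅ := r.2
      rw [← e] at k
      grind
    exact ⟨⟨h₁, h₂, h₃, h₄, hxz, hyt⟩, v, same hx hz h₁ h₂ hxz, same hy ht h₂ h₃ hyt,
      same hz hx h₃ h₄ hxz.symm, same ht hy h₄ h₁ hyt.symm⟩
  · obtain ⟨x, hx, hx0⟩ := hall 0
    exact ⟨⟨x, .inl hx0⟩, hmem _ _ hx, hx0⟩
  · obtain ⟨x, hx, hx3⟩ := hall 3
    refine ⟨⟨x, .inr hx3⟩, hmem _ _ hx, fun h0 => ?_⟩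
    have : Δ.type x = 0 := h0
    rw [this] at hx3
    exact absurd hx3 (by decide)

/-- The objects of the category of homotopy classes of edge-paths in the square complex. -/
abbrev SquarePathObj (Δ : TypedComplex (Fin 4) V) :=
  EdgePathObj (squareComplex Δ).graph (squareComplex Δ).IsSquareWalk

namespace Is353Simplicial

variable (hΔ : Is353Simplicial Δ)
include hΔ

theorem exists_mem_starSet {s : Finset V} (hs : s ∈ Δ.faces) : ∃ x, x ∈ starSet Δ s :=
  (hΔ.isBiclique hs).exists_mem.imp fun _ hx => hx.1

/-- A vertex of the square complex in the star of `v`. -/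
noncomputable def retract (v : V) : {v : V // Δ.type v = 0 ∨ Δ.type v = 3} :=
  (hΔ.exists_mem_starSet (singleton_mem_faces v)).choose

theorem retract_mem (v : V) : hΔ.retract v ∈ starSet Δ {v} :=
  (hΔ.exists_mem_starSet (singleton_mem_faces v)).choose_spec

/-- The unique homotopy class of edge-paths from `x` to `y` in the star of `v`. -/
noncomputable def starPath (v : V) {x y : {v : V // Δ.type v = 0 ∨ Δ.type v = 3}}
    (hx : x ∈ starSet Δ {v}) (hy : y ∈ starSet Δ {v}) : (⟨x⟩ : SquarePathObj Δ) ⟶ ⟨y⟩ :=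
  (hΔ.isBiclique (singleton_mem_faces v)).path hx hy

theorem exists_mem_of_adj {u v : V} (h : Δ.graph.Adj u v) :
    ∃ x, x ∈ starSet Δ {u} ∧ x ∈ starSet Δ {v} := by
  obtain ⟨-, s, hs, hu, hv⟩ := h
  obtain ⟨x, hx⟩ := hΔ.exists_mem_starSet hs
  exact ⟨x, starSet_anti (by simpa using hu) hx, starSet_anti (by simpa using hv) hx⟩

/-- Both equal the path class in the star of the edge `u v`, which lies in both stars. -/
theorem starPath_eq_starPath {u v : V} (h : Δ.graph.Adj u v)
    {x y : {v : V // Δ.type v = 0 ∨ Δ.type v = 3}} (hxu : x ∈ starSet Δ {u})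
    (hyu : y ∈ starSet Δ {u}) (hxv : x ∈ starSet Δ {v}) (hyv : y ∈ starSet Δ {v}) :
    hΔ.starPath u hxu hyu = hΔ.starPath v hxv hyv := by
  classical
  obtain ⟨hne, s, hs, hu, hv⟩ := h
  have huv : {u, v} ∈ Δ.faces := (Δ.isRelLowerSet_faces hs).2
    (by simp [Finset.insert_subset_iff, hu, hv]) (by simp)
  have hmem : ∀ {x}, x ∈ starSet Δ {u} → x ∈ starSet Δ {v} → x ∈ starSet Δ {u, v} := by
    intro x hx hx' w hw
    simp only [Finset.mem_insert, Finset.mem_singleton] at hw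
    rcases hw with rfl | rfl
    exacts [hx _ (by simp), hx' _ (by simp)]
  have e₁ := (hΔ.isBiclique huv).path_mono (hΔ.isBiclique (singleton_mem_faces u))
    (starSet_anti (by simp)) (hmem hxu hxv) (hmem hyu hyv)
  have e₂ := (hΔ.isBiclique huv).path_mono (hΔ.isBiclique (singleton_mem_faces v))
    (starSet_anti (by simp)) (hmem hxu hxv) (hmem hyu hyv)
  exact e₁.symm.trans e₂

theorem starPath_comp (v : V) {x y z : {v : V // Δ.type v = 0 ∨ Δ.type v = 3}}
    (hx : x ∈ starSet Δ {v}) (hy : y ∈ starSet Δ {v}) (hz : z ∈ starSet Δ {v}) :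
    hΔ.starPath v hx hy ≫ hΔ.starPath v hy hz = hΔ.starPath v hx hz :=
  (hΔ.isBiclique (singleton_mem_faces v)).path_comp hx hy hz

theorem starPath_comp_assoc (v : V) {x y z : {v : V // Δ.type v = 0 ∨ Δ.type v = 3}}
    (hx : x ∈ starSet Δ {v}) (hy : y ∈ starSet Δ {v}) (hz : z ∈ starSet Δ {v}) {t : SquarePathObj Δ}
    (f : (⟨z⟩ : SquarePathObj Δ) ⟶ t) :
    hΔ.starPath v hx hy ≫ hΔ.starPath v hy hz ≫ f = hΔ.starPath v hx hz ≫ f :=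
  (hΔ.isBiclique (singleton_mem_faces v)).path_comp_assoc hx hy hz f

theorem starPath_self (v : V) {x : {v : V // Δ.type v = 0 ∨ Δ.type v = 3}}
    (hx : x ∈ starSet Δ {v}) : hΔ.starPath v hx hx = 𝟙 _ :=
  (hΔ.isBiclique (singleton_mem_faces v)).path_self hx

/-- The homotopy class of edge-paths assigned to an edge of `Δ`. -/
noncomputable def edgeMap {u v : V} (h : Δ.graph.Adj u v) :
    (⟨hΔ.retract u⟩ : SquarePathObj Δ) ⟶ ⟨hΔ.retract v⟩ :=
  hΔ.starPath u (hΔ.retract_mem u) (hΔ.exists_mem_of_adj h).choose_spec.1 ≫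
    hΔ.starPath v (hΔ.exists_mem_of_adj h).choose_spec.2 (hΔ.retract_mem v)

theorem edgeMap_eq {u v : V} (h : Δ.graph.Adj u v)
    {x : {v : V // Δ.type v = 0 ∨ Δ.type v = 3}} (hu : x ∈ starSet Δ {u})
    (hv : x ∈ starSet Δ {v}) :
    hΔ.edgeMap h = hΔ.starPath u (hΔ.retract_mem u) hu ≫ hΔ.starPath v hv (hΔ.retract_mem v) := by
  have hm := (hΔ.exists_mem_of_adj h).choose_spec
  have e := hΔ.starPath_eq_starPath h hu hm.1 hv hm.2
  rw [edgeMap, ← hΔ.starPath_comp u (hΔ.retract_mem u) hu hm.1, e, Category.assoc, starPath_comp]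

/-- The homotopy class of edge-paths assigned to an edge-path of `Δ`. -/
noncomputable def walkMap : ∀ {u v : V}, Δ.graph.Walk u v →
    ((⟨hΔ.retract u⟩ : SquarePathObj Δ) ⟶ ⟨hΔ.retract v⟩)
  | _, _, .nil => 𝟙 _
  | _, _, .cons h p => hΔ.edgeMap h ≫ walkMap p

theorem walkMap_append {u v w : V} (p : Δ.graph.Walk u v) (q : Δ.graph.Walk v w) :
    hΔ.walkMap (p.append q) = hΔ.walkMap p ≫ hΔ.walkMap q := by
  induction p with
  | nil => simp [walkMap]
  | cons h p ih => simp [walkMap, ih]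

/-- By `edgeMap_eq` the image of an edge may be routed through any vertex in both stars. For a
triangle, one vertex in the star of the whole simplex serves for all three edges, and the composite
telescopes. -/
theorem walkMap_eq_of_homotopic {u v : V} {p q : Δ.graph.Walk u v}
    (h : EdgeHomotopic Δ.graph (IsTriangle Δ.toPreAbstractSimplicialComplex) p q) :
    hΔ.walkMap p = hΔ.walkMap q := by
  induction h with
  | refl => rfl
  | symm _ ih => exact ih.symm
  | trans _ _ ih ih' => exact ih.trans ih'
  | append _ _ ih ih' => rw [walkMap_append, walkMap_append, ih, ih']
  | backtrack h =>
    obtain ⟨x, hu, hv⟩ := hΔ.exists_mem_of_adj h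
    simp only [walkMap, hΔ.edgeMap_eq h hu hv, hΔ.edgeMap_eq h.symm hv hu, Category.assoc,
      Category.comp_id, starPath_comp_assoc, starPath_comp, starPath_self, Category.id_comp]
  | cell w hw =>
    obtain ⟨hl, s, hs, hws⟩ := hw
    match w, hl, hws with
    | .cons (v := v) h₁ (.cons (v := w) h₂ (.cons h₃ .nil)), _, hws =>
      obtain ⟨x, hx⟩ := hΔ.exists_mem_starSet hs
      have hmem : ∀ y ∈ s, x ∈ starSet Δ {y} := fun y hy => starSet_anti (by simpa using hy) hx
      have hu := hmem _ (hws _ (.head _))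
      have hv := hmem v (hws v (.tail _ (.head _)))
      have hw := hmem w (hws w (.tail _ (.tail _ (.head _))))
      simp only [walkMap, hΔ.edgeMap_eq h₁ hu hv, hΔ.edgeMap_eq h₂ hv hw, hΔ.edgeMap_eq h₃ hw hu,
        Category.assoc, Category.comp_id, starPath_comp_assoc, starPath_comp, starPath_self,
        Category.id_comp]

/-- Pushing a path of `X` through `Δ` and back changes it only by star paths at its ends: an edge `x
y` already lies in the star of `y`, and the connecting paths at interior vertices cancel. -/
theorem edgePathClass_eq_walkMap {x y : {v : V // Δ.type v = 0 ∨ Δ.type v = 3}}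
    (p : (squareComplex Δ).graph.Walk x y) :
    edgePathClass (squareComplex Δ).IsSquareWalk p =
      hΔ.starPath x.1 (self_mem_starSet x) (hΔ.retract_mem x.1) ≫
        hΔ.walkMap (includeWalk p) ≫
        hΔ.starPath y.1 (hΔ.retract_mem y.1) (self_mem_starSet y) := by
  induction p with
  | nil =>
    rw [includeWalk, walkMap, Category.id_comp, starPath_comp, starPath_self, edgePathClass_nil]
  | @cons x y z h p ih =>
    have hxy : x ∈ starSet Δ {y.1} := mem_starSet_singleton.2 (.inr h)
    have e : edgePathClass (squareComplex Δ).IsSquareWalk (.cons h .nil) =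
        hΔ.starPath y.1 hxy (self_mem_starSet y) :=
      ((hΔ.isBiclique (singleton_mem_faces y.1)).path_edge hxy (self_mem_starSet y) h).symm
    have e' := hΔ.edgeMap_eq (u := x.1) (v := y.1) h (self_mem_starSet x) hxy
    have ew : hΔ.walkMap (includeWalk (.cons h p)) =
        hΔ.edgeMap (u := x.1) (v := y.1) h ≫ hΔ.walkMap (includeWalk p) := rfl
    rw [edgePathClass_cons, ih, e, starPath_comp_assoc, ew, e', Category.assoc, Category.assoc,
      starPath_comp_assoc, starPath_self, Category.id_comp]

/-- A path in `Δ` between vertices of `X` is pushed into `X`, which gives connectedness. A closed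
path of `X` is null-homotopic in `Δ`, so its pushed image is trivial, and it differs from that image
only by star paths that cancel. -/
theorem simplyConnected_squareComplex :
    SimplyConnected (squareComplex Δ).graph (squareComplex Δ).IsSquareWalk := by
  obtain ⟨hc, hn⟩ := hΔ.simplyConnected
  have reach : ∀ {x y : {v : V // Δ.type v = 0 ∨ Δ.type v = 3}},
      ((⟨x⟩ : SquarePathObj Δ) ⟶ ⟨y⟩) → (squareComplex Δ).graph.Reachable x y := fun f =>
    Quotient.inductionOn f fun p => ⟨p⟩
  refine ⟨(SimpleGraph.connected_iff _).2 ⟨fun x y => ?_, ?_⟩, fun x p => ?_⟩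
  · obtain ⟨p⟩ := hc.preconnected x.1 y.1
    exact reach (hΔ.starPath x.1 (self_mem_starSet x) (hΔ.retract_mem x.1) ≫ hΔ.walkMap p ≫
      hΔ.starPath y.1 (hΔ.retract_mem y.1) (self_mem_starSet y))
  · obtain ⟨v⟩ := hc.nonempty
    exact ⟨hΔ.retract v⟩
  · rw [← edgePathClass_eq_iff, hΔ.edgePathClass_eq_walkMap,
      hΔ.walkMap_eq_of_homotopic (hn x.1 (includeWalk p))]
    rw [walkMap, Category.id_comp, starPath_comp, starPath_self, edgePathClass_nil]

end Is353Simplicial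

end ThreeFiveThree

theorem theorem9p2 {V : Type*} (Δ : ThreeFiveThree.TypedComplex (Fin 4) V)
    (hΔ : ThreeFiveThree.Is353Simplicial Δ) :
    (ThreeFiveThree.squareComplex Δ).Is353 := by
  have h := hΔ.is353Graph
  have m := ThreeFiveThree.isModelOf_squareComplex Δ
  have m' := ThreeFiveThree.isModelOf_swap_squareComplex Δ
  exact ⟨hΔ.simplyConnected_squareComplex, m.axiom1 h, m.axiom2 h, m.axiom3 h, m.axiom4 h,
    m'.axiom1 h.dual, m'.axiom2 h.dual, m'.axiom3 h.dual, m'.axiom4 h.dual⟩
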